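/- Let $\Theta\subseteq\mathbb R^p$ be open and let $f(x;\theta)>0$ ($x\in\mathfrak X$, $\theta\in\Theta$) be a family of probability densities with respect to a measure $\mu$ that is four times continuously differentiable in $\theta$ (this holds if it is five times differentiable). Write $\partial_i=\partial/\partial\theta^i$, $f_i=\partial_i f$, $f_{ij}=\partial_i\partial_jf$, $l_i=\partial_i\log f$, $l_{ij}=\partial_i\partial_j\log f$, etc., and $E_\theta[h]=\int h\,f(x;\theta)\,d\mu$. Call $|I_1|+\dots+|I_r|$ the order of a product $l_{I_1}\cdots l_{I_r}$ of log-likelihood derivatives. Assume that all such products of order at most $4$ have finite expectation, that $\partial_i\int l_{I_1}\cdots l_{I_r}f\,d\mu=\int\partial_i(l_{I_1}\cdots l_{I_r}f)\,d\mu$ for those of order at most $3$ (including the empty product), and that the Fisher information matrix is positive definite at every $\theta\in\Theta$. Repeated indices are summed over $1,\dots,p$. **Geometry.** Tangent vectors $v,w$ (functions on $\mathfrak X$) at a positive function $q$ have inner product $\langle v,w\rangle=\int q^{-1}vw\,d\mu$, and the $\alpha$-representation of $v$ is $q^{-(1+\alpha)/2}v$ ($\alpha\in\mathbb R$; $e$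 means $\alpha=1$ and $m$ means $\alpha=-1$). Along a family $q(x;\eta)$ the coordinate vector $\partial_i$ is $\partial q/\partial\eta^i$, and $\overset{\alpha}{\overline\nabla}_{\partial_i}A$ is the vector field whose $\alpha$-representation is the $\partial_i$-derivative of the $\alpha$-representation of $A$. Let $\tilde f(x;\theta^0,\theta)=e^{\theta^0}f(x;\theta)$ and evaluate everything at $(0,\theta)$. Put - $g_{ij}=\langle\partial_i,\partial_j\rangle$ (Fisher metric), $(g^{ij})=(g_{ij})^{-1}$, $\overset{\alpha}{\Gamma}_{ij,k}=\langle\overset{\alpha}{\overline\nabla}_{\partial_i}\partial_j,\partial_k\rangle$, $\overset{\alpha}{\Gamma}{}_{ij}^{k}=\overset{\alpha}{\Gamma}_{ij,t}\,g^{kt}$; - $T_{ijk}=\overset{m}{\Gamma}_{ij,k}-\overset{e}{\Gamma}_{ij,k}$, $T_{ij}^k=T_{ijl}g^{lk}$, $T_i^{jk}=T_{iml}g^{mj}g^{lk}$, $T^{ijk}=T_{tml}g^{ti}g^{mj}g^{lk}$; - $\overset{\alpha}{F}=g^{ks}\partial_sT^i_{ik}-g^{ti}\,\overset{\alpha}{\Gamma}_{it,s}\,T_j^{js}$;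 - $\overset{e}{R}{}_{ij}{}^{kl}=\overset{e}{R}{}_{ijs}{}^{l}g^{sk}$, where $\overset{e}{R}(\partial_i,\partial_j)\partial_k=\overset{e}{R}{}_{ijk}{}^{l}\,\partial_l$ is the curvature $R(A,B)C=\nabla_A\nabla_BC-\nabla_B\nabla_AC-\nabla_{AB-BA}C$ of the connection $\overset{e}{\nabla}_{\partial_i}\partial_j=\overset{e}{\Gamma}{}_{ij}^{t}\,\partial_t$; - $\overset{\alpha}{H}_{ij}$ $(1\le i,j\le p)$, the second fundamental form: $\overset{\alpha}{\overline\nabla}_{\partial_i}\partial_j$ (taken along $\tilde f$) minus its orthogonal projection onto $\mathrm{span}(\partial_0,\dots,\partial_p)$; and $\overset{\alpha}{H}{}_i^{j}=\overset{\alpha}{H}_{ik}\,g^{kj}$. **Moments.** $L_{(ij)}=E_\theta[l_{ij}]$, $L_{ij}=E_\theta[l_il_j]$, $L_{(ij)k}=E_\theta[l_{ij}l_k]$, $L_{ijk}=E_\theta[l_il_jl_k]$, $L_{(ij)(kl)}=E_\theta[l_{ij}l_{kl}]$, $L_{(ij)kl}=E_\theta[l_{ij}l_kl_l]$, $L_{ijkl}=E_\theta[l_il_jl_kl_l]$,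 and $$\begin{aligned} &L11=g^{ij}g^{kl}L_{(il)jk},\quad L12=g^{ij}g^{kl}L_{(ij)kl},\quad L13=g^{ij}g^{kl}L_{ijkl},\quad L14=g^{ij}g^{kl}L_{(ik)(jl)},\quad L15=g^{ij}g^{kl}L_{(ij)(kl)},\\ &L21=g^{ij}g^{kl}g^{su}L_{(ik)s}L_{jlu},\quad L22=g^{ij}g^{kl}g^{su}L_{(ij)k}L_{lsu},\quad L23=g^{ij}g^{kl}g^{su}L_{iks}L_{jlu},\\ &L24=g^{ij}g^{kl}g^{su}L_{ijk}L_{lsu},\quad L25=g^{ij}g^{kl}g^{su}L_{(ik)s}L_{(jl)u},\quad L26=g^{ij}g^{kl}g^{su}L_{(ij)k}L_{(su)l}. \end{aligned}$$ **Claim.** For every $\theta\in\Theta$, the following integrals and partial derivatives exist: the integrals defining $\langle\partial_i,\partial_j\rangle$ $(0\le i,j\le p)$, $\langle\overset{\alpha}{\overline\nabla}_{\partial_i}\partial_j,\partial_k\rangle$ $(1\le i,j\le p$, $0\le k\le p$, $\alpha\in\mathbb R)$, $\langle\overset{e}{H}_{ij},\overset{e}{H}_{kl}\rangle$ and $\langle\overset{e}{H}_{ij},\overset{m}{H}_{kl}\rangle$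 $(1\le i,j,k,l\le p)$, and the partial derivatives $\partial_sT^i_{ik}$ and $\partial_s\overset{e}{\Gamma}{}_{ij}^{k}$. Moreover, with $\alpha'=(1-\alpha)/2$ and for every $\alpha\in\mathbb R$, $$\begin{aligned} g_{ij}&=L_{ij}=-L_{(ij)},\\ \overset{\alpha}{F}&=g^{ij}g^{ks}(2L_{(is)jk}+L_{(ks)ij}+L_{ijks})-g^{ks}g^{uj}g^{li}L_{ijk}(2L_{(su)l}+L_{sul})\\ &\quad-g^{ti}g^{uj}g^{ks}(L_{(it)s}+\alpha'L_{its})L_{juk}\\ &=2L11+L12+L13-2L21-L23-L22-\alpha'L24,\\ T_{ijk}T^{ijk}&=L_{ijk}L_{stu}g^{is}g^{jt}g^{ku}=L23,\\ T^i_{is}T_j^{js}&=L_{ijk}L_{stu}g^{ij}g^{st}g^{uk}=L24,\\ \overset{e}{R}{}_{ij}{}^{ij}&=g^{ij}g^{sk}(L_{(ki)(js)}-L_{(ij)(ks)}+L_{(ki)js}-L_{(ij)ks})\\ &\quad+g^{sk}g^{ti}g^{uj}(-L_{(ki)j}L_{(st)u}+L_{(it)s}L_{(uj)k}+L_{sit}L_{(uj)k}-L_{stu}L_{(ij)k})\\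 &=L14-L15+L11-L12-L25+L26+L22-L21,\\ \langle\overset{e}{H}{}_i^j,\overset{e}{H}{}_j^i\rangle&=g^{jk}g^{li}L_{(ik)(jl)}-g^{jk}g^{li}g^{st}L_{(ik)s}L_{(jl)t}-p=L14-L25-p,\\ \langle\overset{e}{H}{}_i^i,\overset{e}{H}{}_j^j\rangle&=g^{ik}g^{jl}L_{(ik)(jl)}-g^{ik}g^{jl}g^{st}L_{(ik)s}L_{(jl)t}-p^2=L15-L26-p^2,\\ \langle\overset{e}{H}{}_i^j,\overset{m}{H}{}_j^i\rangle&=g^{jk}g^{li}(L_{(ik)jl}+L_{(ik)(jl)})-g^{jk}g^{li}g^{st}L_{(ik)s}(L_{(jl)t}+L_{jlt})=L11+L14-L25-L21,\\ \langle\overset{e}{H}{}_i^i,\overset{m}{H}{}_j^j\rangle&=g^{ik}g^{jl}(L_{(ik)jl}+L_{(ik)(jl)})-g^{ik}g^{jl}g^{st}L_{(ik)s}(L_{(jl)t}+L_{jlt})=L12+L15-L26-L22. \end{aligned}$$ -/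

import Mathlib

open MeasureTheory

noncomputable section

namespace InfoGeom

/-! ### Partial derivatives -/

/-- The partial derivative `∂_i F` at `θ`. -/
def partialD {n : ℕ} (i : Fin n) (F : (Fin n → ℝ) → ℝ) (θ : Fin n → ℝ) : ℝ :=
  lineDeriv ℝ F θ (Pi.single i 1)

/-- `iterPartial [i, j, …] F = ∂_i ∂_j ⋯ F`. -/
def iterPartial {n : ℕ} : List (Fin n) → ((Fin n → ℝ) → ℝ) → (Fin n → ℝ) → ℝ
  | [], F => F
  | i :: I, F => partialD i (iterPartial I F)

/-! ### Log-likelihood derivatives and their moments -/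

/-- `l_I (x; θ) = ∂_I log f (x; θ)`. -/
def logD {X : Type*} {p : ℕ} (f : X → (Fin p → ℝ) → ℝ) (I : List (Fin p)) (x : X)
    (θ : Fin p → ℝ) : ℝ :=
  iterPartial I (fun η => Real.log (f x η)) θ

/-- The integrand `(l_{I₁} l_{I₂} ⋯ l_{I_r}) (x; θ) · f (x; θ)`. -/
def momentIntegrand {X : Type*} {p : ℕ} (f : X → (Fin p → ℝ) → ℝ) (Is : List (List (Fin p)))
    (x : X) (θ : Fin p → ℝ) : ℝ :=
  (Is.map fun I => logD f I x θ).prod * f x θ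

/-- `E_θ[l_{I₁} l_{I₂} ⋯ l_{I_r}]`. For example `L_{(ij)k} = moment μ f [[i, j], [k]] θ` and
`L_{ijk} = moment μ f [[i], [j], [k]] θ`. -/
def moment {X : Type*} [MeasurableSpace X] (μ : Measure X) {p : ℕ} (f : X → (Fin p → ℝ) → ℝ)
    (Is : List (List (Fin p))) (θ : Fin p → ℝ) : ℝ :=
  ∫ x, momentIntegrand f Is x θ ∂μ

/-! ### The ambient space of functions on `X`

A tangent vector at `q` is given by its velocity `v = ∂_u g(·; u)` at `u = 0`, where `g(·; 0) = q`;
its `α`-representation is `q ^ (-(1 + α) / 2) * v`. -/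

/-- The integrand of `⟨v, w⟩_q`. -/
def innerIntegrand {X : Type*} (q v w : X → ℝ) (x : X) : ℝ :=
  (q x)⁻¹ * v x * w x

/-- `⟨v, w⟩_q = ∫ q⁻¹ v w dμ`. -/
def ambientInner {X : Type*} [MeasurableSpace X] (μ : Measure X) (q v w : X → ℝ) : ℝ :=
  ∫ x, innerIntegrand q v w x ∂μ

/-- The `α`-representation of the tangent vector `v` at `q`. -/
def alphaRep {X : Type*} (α : ℝ) (q v : X → ℝ) (x : X) : ℝ :=
  q x ^ (-(1 + α) / 2) * v x

/-- The tangent vector at `q` whose `α`-representation is `a`. -/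
def ofAlphaRep {X : Type*} (α : ℝ) (q a : X → ℝ) (x : X) : ℝ :=
  q x ^ ((1 + α) / 2) * a x

/-! ### Geometry of a finite-dimensional family of positive functions -/

/-- The coordinate tangent vector `∂_i` at `θ`. -/
def coordVec {X : Type*} {n : ℕ} (f : X → (Fin n → ℝ) → ℝ) (i : Fin n) (θ : Fin n → ℝ)
    (x : X) : ℝ :=
  partialD i (f x) θ

/-- The `α`-covariant derivative in the ambient space, in the direction `∂_i`, of a vector field `A`
along the family: its `α`-representation is the `∂_i`-derivative of the `α`-representation
of `A`. -/
def ambientCov {X : Type*} {n : ℕ} (α : ℝ) (f : X → (Fin n → ℝ) → ℝ) (i : Fin n)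
    (A : (Fin n → ℝ) → X → ℝ) (θ : Fin n → ℝ) : X → ℝ :=
  ofAlphaRep α (fun x => f x θ)
    (fun x => partialD i (fun η => alphaRep α (fun y => f y η) (A η) x) θ)

/-- The matrix `⟨∂_i, ∂_j⟩_θ`. -/
def metric {X : Type*} [MeasurableSpace X] (μ : Measure X) {n : ℕ} (f : X → (Fin n → ℝ) → ℝ)
    (θ : Fin n → ℝ) : Matrix (Fin n) (Fin n) ℝ :=
  Matrix.of fun i j => ambientInner μ (fun x => f x θ) (coordVec f i θ) (coordVec f j θ)

/-- `⟨∇̄^α_{∂_i} ∂_j, ∂_k⟩_θ`. -/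
def christoffelFamily {X : Type*} [MeasurableSpace X] (μ : Measure X) {n : ℕ} (α : ℝ)
    (f : X → (Fin n → ℝ) → ℝ) (i j k : Fin n) (θ : Fin n → ℝ) : ℝ :=
  ambientInner μ (fun x => f x θ) (ambientCov α f i (coordVec f j) θ) (coordVec f k θ)

/-- Orthogonal projection of an ambient tangent vector onto the tangent space of the family:
`∑ ⟨v, ∂_i⟩ g^{ij} ∂_j`. -/
def tangentProj {X : Type*} [MeasurableSpace X] (μ : Measure X) {n : ℕ}
    (f : X → (Fin n → ℝ) → ℝ) (θ : Fin n → ℝ) (v : X → ℝ) (x : X) : ℝ :=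
  ∑ i, ∑ j, ambientInner μ (fun y => f y θ) v (coordVec f i θ) * (metric μ f θ)⁻¹ i j
    * coordVec f j θ x

/-- The second fundamental form of the family in the ambient space: the `α`-covariant derivative
minus its orthogonal projection. -/
def secondFundFamily {X : Type*} [MeasurableSpace X] (μ : Measure X) {n : ℕ} (α : ℝ)
    (f : X → (Fin n → ℝ) → ℝ) (i j : Fin n) (θ : Fin n → ℝ) (x : X) : ℝ :=
  ambientCov α f i (coordVec f j) θ x
    - tangentProj μ f θ (ambientCov α f i (coordVec f j) θ) x

/-! ### The scale extension of a statistical model -/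

/-- `f̃ (x; θ⁰, θ) = e^{θ⁰} f (x; θ)`; the coordinate `θ⁰` has index `0`, and `θ^i` has index
`i.succ`. -/
def scaleExt {X : Type*} {p : ℕ} (f : X → (Fin p → ℝ) → ℝ) : X → (Fin (p + 1) → ℝ) → ℝ :=
  fun x η => Real.exp (η 0) * f x (fun i => η i.succ)

/-- The point `(0, θ)`. -/
def basePt {p : ℕ} (θ : Fin p → ℝ) : Fin (p + 1) → ℝ := Matrix.vecCons 0 θ

/-! ### The geometry of the model; `α = 1` is `e`, `α = -1` is `m` -/

/-- The inverse Fisher metric `g^{ij}`. -/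
def gInv {X : Type*} [MeasurableSpace X] (μ : Measure X) {p : ℕ} (f : X → (Fin p → ℝ) → ℝ)
    (θ : Fin p → ℝ) : Matrix (Fin p) (Fin p) ℝ :=
  (metric μ f θ)⁻¹

/-- `Γ^α_{ij,k} (θ)`. -/
def Gam {X : Type*} [MeasurableSpace X] (μ : Measure X) {p : ℕ} (α : ℝ)
    (f : X → (Fin p → ℝ) → ℝ) (i j k : Fin p) (θ : Fin p → ℝ) : ℝ :=
  christoffelFamily μ α (scaleExt f) i.succ j.succ k.succ (basePt θ)

/-- `Γ^α_{ij}{}^k (θ)`: the coefficients of the `α`-connection of the model. -/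
def GamUp {X : Type*} [MeasurableSpace X] (μ : Measure X) {p : ℕ} (α : ℝ)
    (f : X → (Fin p → ℝ) → ℝ) (i j k : Fin p) (θ : Fin p → ℝ) : ℝ :=
  ∑ t, Gam μ α f i j t θ * gInv μ f θ k t

/-- `T_{ijk}`. -/
def T3 {X : Type*} [MeasurableSpace X] (μ : Measure X) {p : ℕ} (f : X → (Fin p → ℝ) → ℝ)
    (i j k : Fin p) (θ : Fin p → ℝ) : ℝ :=
  Gam μ (-1) f i j k θ - Gam μ 1 f i j k θ

/-- `T_{ij}^k`. -/
def T21 {X : Type*} [MeasurableSpace X] (μ : Measure X) {p : ℕ} (f : X → (Fin p → ℝ) → ℝ)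
    (i j k : Fin p) (θ : Fin p → ℝ) : ℝ :=
  ∑ l, T3 μ f i j l θ * gInv μ f θ l k

/-- `T_i^{jk}`. -/
def T12 {X : Type*} [MeasurableSpace X] (μ : Measure X) {p : ℕ} (f : X → (Fin p → ℝ) → ℝ)
    (i j k : Fin p) (θ : Fin p → ℝ) : ℝ :=
  ∑ l, ∑ m, T3 μ f i m l θ * gInv μ f θ m j * gInv μ f θ l k

/-- `T^{ijk}`. -/
def T03 {X : Type*} [MeasurableSpace X] (μ : Measure X) {p : ℕ} (f : X → (Fin p → ℝ) → ℝ)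
    (i j k : Fin p) (θ : Fin p → ℝ) : ℝ :=
  ∑ t, ∑ m, ∑ l, T3 μ f t m l θ * gInv μ f θ t i * gInv μ f θ m j * gInv μ f θ l k

/-- `∑_i T_{ik}^i` as a function of `θ`. -/
def traceT {X : Type*} [MeasurableSpace X] (μ : Measure X) {p : ℕ} (f : X → (Fin p → ℝ) → ℝ)
    (k : Fin p) (θ : Fin p → ℝ) : ℝ :=
  ∑ i, T21 μ f i k i θ

/-- `F^α = g^{ks} ∂_s T_{ik}^i - g^{ti} Γ^α_{it,s} T_j^{js}`. -/
def FAlpha {X : Type*} [MeasurableSpace X] (μ : Measure X) {p : ℕ} (α : ℝ)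
    (f : X → (Fin p → ℝ) → ℝ) (θ : Fin p → ℝ) : ℝ :=
  (∑ k, ∑ s, gInv μ f θ k s * partialD s (traceT μ f k) θ)
    - ∑ i, ∑ j, ∑ s, ∑ t, gInv μ f θ t i * Gam μ α f i t s θ * T12 μ f j j s θ

/-- The covariant derivative `∇_A C` of vector fields (given by their components) for the connection
with coefficients `Γ i j k = Γ_{ij}^k`. -/
def covDeriv {p : ℕ} (Γ : Fin p → Fin p → Fin p → (Fin p → ℝ) → ℝ)
    (A C : (Fin p → ℝ) → Fin p → ℝ) (θ : Fin p → ℝ) (l : Fin p) : ℝ :=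
  ∑ i, A θ i * (partialD i (fun η => C η l) θ + ∑ r, Γ i r l θ * C θ r)

/-- The commutator `AB - BA` of vector fields. -/
def bracket {p : ℕ} (A B : (Fin p → ℝ) → Fin p → ℝ) (θ : Fin p → ℝ) (l : Fin p) : ℝ :=
  ∑ i, (A θ i * partialD i (fun η => B η l) θ - B θ i * partialD i (fun η => A η l) θ)

/-- `R(A, B) C = ∇_A ∇_B C - ∇_B ∇_A C - ∇_{AB - BA} C`. -/
def curvature {p : ℕ} (Γ : Fin p → Fin p → Fin p → (Fin p → ℝ) → ℝ)
    (A B C : (Fin p → ℝ) → Fin p → ℝ) (θ : Fin p → ℝ) (l : Fin p) : ℝ :=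
  covDeriv Γ A (covDeriv Γ B C) θ l - covDeriv Γ B (covDeriv Γ A C) θ l
    - covDeriv Γ (bracket A B) C θ l

/-- `R_{ijk}{}^l` of the `e`-connection: `R(∂_i, ∂_j) ∂_k = ∑ R_{ijk}{}^l ∂_l`. -/
def Re31 {X : Type*} [MeasurableSpace X] (μ : Measure X) {p : ℕ} (f : X → (Fin p → ℝ) → ℝ)
    (i j k l : Fin p) (θ : Fin p → ℝ) : ℝ :=
  curvature (GamUp μ 1 f) (fun _ => Pi.single i 1) (fun _ => Pi.single j 1)
    (fun _ => Pi.single k 1) θ l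

/-- `R_{ij}{}^{kl}` of the `e`-connection. -/
def Re22 {X : Type*} [MeasurableSpace X] (μ : Measure X) {p : ℕ} (f : X → (Fin p → ℝ) → ℝ)
    (i j k l : Fin p) (θ : Fin p → ℝ) : ℝ :=
  ∑ s, Re31 μ f i j s l θ * gInv μ f θ s k

/-- The second fundamental form with lower indices `i j`: that of the scale extension of the model,
at `(0, θ)`. -/
def secFF {X : Type*} [MeasurableSpace X] (μ : Measure X) {p : ℕ} (α : ℝ)
    (f : X → (Fin p → ℝ) → ℝ) (i j : Fin p) (θ : Fin p → ℝ) : X → ℝ :=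
  secondFundFamily μ α (scaleExt f) i.succ j.succ (basePt θ)

/-- The second fundamental form with one index raised, `∑_k (secFF)_{ik} g^{kj}`. -/
def secFFMixed {X : Type*} [MeasurableSpace X] (μ : Measure X) {p : ℕ} (α : ℝ)
    (f : X → (Fin p → ℝ) → ℝ) (i j : Fin p) (θ : Fin p → ℝ) (x : X) : ℝ :=
  ∑ k, secFF μ α f i k θ x * gInv μ f θ k j

/-! ### Contracted moments -/

/-- `g^{ij} g^{kl} A_{ijkl}`. -/
def contract4 {p : ℕ} (g : Matrix (Fin p) (Fin p) ℝ)
    (A : Fin p → Fin p → Fin p → Fin p → ℝ) : ℝ :=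
  ∑ i, ∑ j, ∑ k, ∑ l, g i j * g k l * A i j k l

/-- `g^{ij} g^{kl} g^{su} A_{ijklsu}`. -/
def contract6 {p : ℕ} (g : Matrix (Fin p) (Fin p) ℝ)
    (A : Fin p → Fin p → Fin p → Fin p → Fin p → Fin p → ℝ) : ℝ :=
  ∑ i, ∑ j, ∑ k, ∑ l, ∑ s, ∑ u, g i j * g k l * g s u * A i j k l s u

section Contractions

variable {X : Type*} [MeasurableSpace X] (μ : Measure X) {p : ℕ} (f : X → (Fin p → ℝ) → ℝ)
  (θ : Fin p → ℝ)

def L11 : ℝ := contract4 (gInv μ f θ) fun i j k l => moment μ f [[i, l], [j], [k]] θ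
def L12 : ℝ := contract4 (gInv μ f θ) fun i j k l => moment μ f [[i, j], [k], [l]] θ
def L13 : ℝ := contract4 (gInv μ f θ) fun i j k l => moment μ f [[i], [j], [k], [l]] θ
def L14 : ℝ := contract4 (gInv μ f θ) fun i j k l => moment μ f [[i, k], [j, l]] θ
def L15 : ℝ := contract4 (gInv μ f θ) fun i j k l => moment μ f [[i, j], [k, l]] θ
def L21 : ℝ := contract6 (gInv μ f θ) fun i j k l s u =>
  moment μ f [[i, k], [s]] θ * moment μ f [[j], [l], [u]] θ
def L22 : ℝ := contract6 (gInv μ f θ) fun i j k l s u =>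
  moment μ f [[i, j], [k]] θ * moment μ f [[l], [s], [u]] θ
def L23 : ℝ := contract6 (gInv μ f θ) fun i j k l s u =>
  moment μ f [[i], [k], [s]] θ * moment μ f [[j], [l], [u]] θ
def L24 : ℝ := contract6 (gInv μ f θ) fun i j k l s u =>
  moment μ f [[i], [j], [k]] θ * moment μ f [[l], [s], [u]] θ
def L25 : ℝ := contract6 (gInv μ f θ) fun i j k l s u =>
  moment μ f [[i, k], [s]] θ * moment μ f [[j, l], [u]] θ
def L26 : ℝ := contract6 (gInv μ f θ) fun i j k l s u =>
  moment μ f [[i, j], [k]] θ * moment μ f [[s, u], [l]] θ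

end Contractions

/-! ### Regular statistical models -/

/-- A regular parametric model with positive densities `f (x; θ)`, `θ ∈ Θ`, with respect to `μ`.

The order of a product `l_{I₁} ⋯ l_{I_r}` of log-likelihood derivatives is `|I₁| + ⋯ + |I_r|`, so
the empty product has order `0`. All such products of order at most `4` have finite expectation,
and `∂_i ∫ l_{I₁} ⋯ l_{I_r} f dμ = ∫ ∂_i (l_{I₁} ⋯ l_{I_r} f) dμ` for those of order at
most `3`. -/
structure RegularModel {X : Type*} [MeasurableSpace X] (μ : Measure X) {p : ℕ}
    (Θ : Set (Fin p → ℝ)) (f : X → (Fin p → ℝ) → ℝ) : Prop where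
  isOpen : IsOpen Θ
  pos : ∀ x, ∀ θ ∈ Θ, 0 < f x θ
  density : ∀ θ ∈ Θ, ∫ x, f x θ ∂μ = 1
  smooth : ∀ x, ContDiffOn ℝ 4 (f x) Θ
  finite_moment : ∀ Is : List (List (Fin p)), (∀ I ∈ Is, I ≠ []) →
    (Is.map List.length).sum ≤ 4 → ∀ θ ∈ Θ, Integrable (fun x => momentIntegrand f Is x θ) μ
  exchange : ∀ Is : List (List (Fin p)), (∀ I ∈ Is, I ≠ []) →
    (Is.map List.length).sum ≤ 3 → ∀ θ ∈ Θ, ∀ i : Fin p,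
      HasLineDerivAt ℝ (fun η => ∫ x, momentIntegrand f Is x η ∂μ)
        (∫ x, partialD i (momentIntegrand f Is x) θ ∂μ) θ (Pi.single i 1)
  metric_posDef : ∀ θ ∈ Θ, (metric μ f θ).PosDef

end InfoGeom

end

open InfoGeom

/-! Every tangent vector in play has the form `u * f`, and `⟨u f, v f⟩ = E[u v]`, so the geometry
becomes least squares in `L²(f dμ)`. In this picture `∂_0` is the function `1`, `∂_i` is the score
`l_i`, and `∇̄^α_{∂_i} ∂_j` is `l_ij + α' l_i l_j` with `α' = (1 - α)/2` (`ambientCov_scaleExt`).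
Hence `Γ^α_{ij,k} = L_{(ij)k} + α' L_{ijk}` and `T_{ijk} = L_{ijk}`.

The scores are centred, so the metric of the scale extension is block diagonal, and the second
fundamental form is the residual of `l_ij + α' l_i l_j` after regression on `1` and the scores
(`secFF_eq`). The mean of a product of two such residuals is `E[AB] - E[A] E[B]` minus the
contraction of their score covariances with `g⁻¹` (`HasMean.residual_mul`). Since `E[l_ij] = -g_ij`,
the product of the means is `(1 - α') g_ij g_kl`; its contractions give the terms `p` and `p²` for
`e` with `e`, and nothing for `e` with `m`.

`F^α` and the curvature also need derivatives in `θ`. Differentiation under the integral turns the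
derivative of a moment into a sum of moments of one order higher, and the inverse metric satisfies
`∂_s g⁻¹ = -g⁻¹ (∂_s g) g⁻¹` (`hasLineDerivAt_traceT`, `hasLineDerivAt_GamUp`). In the curvature,
third derivatives of `log f` cancel by antisymmetry, and the quadratic terms in `Γ` cancel half of
the terms from `∂ g⁻¹` (`curvature_third`).

What remains is a finite list of identities between full contractions. Each is a renaming of
summation indices combined with the symmetries of `g⁻¹` and of the moments (`sum4_reindex`,
`sum6_reindex`, `MomentSymmetry`). -/

namespace InfoGeom

open Filter Topology

/-! ### Calculus of line derivatives -/

section LineDeriv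

variable {E : Type*} [NormedAddCommGroup E] [NormedSpace ℝ E] {F G : E → ℝ} {F' G' : ℝ} {x v : E}

lemma hasLineDerivAt_mul (hF : HasLineDerivAt ℝ F F' x v) (hG : HasLineDerivAt ℝ G G' x v) :
    HasLineDerivAt ℝ (fun y => F y * G y) (F' * G x + F x * G') x v := by
  simpa using! HasDerivAt.mul hF hG

lemma hasLineDerivAt_sum {ι : Type*} {s : Finset ι} {F : ι → E → ℝ} {F' : ι → ℝ}
    (h : ∀ i ∈ s, HasLineDerivAt ℝ (F i) (F' i) x v) :
    HasLineDerivAt ℝ (fun y => ∑ i ∈ s, F i y) (∑ i ∈ s, F' i) x v :=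
  HasDerivAt.fun_sum h

/-- The identity `N(t)⁻¹ - N(0)⁻¹ = -N(t)⁻¹ (N(t) - N(0)) N(0)⁻¹` reduces the slope of the inverse
to the slope of `N` and continuity of inversion. Everything happens along one line, because the
exchange hypothesis gives only directional derivatives of the metric. -/
lemma tendsto_inv_slope {n : Type*} [Fintype n] [DecidableEq n] {N : ℝ → Matrix n n ℝ}
    {N' : Matrix n n ℝ} (h : ∀ a b, HasDerivAt (fun t => N t a b) (N' a b) 0)
    (hdet : (N 0).det ≠ 0) :
    Tendsto (fun t => t⁻¹ • ((N t)⁻¹ - (N 0)⁻¹)) (𝓝[≠] 0) (𝓝 (-((N 0)⁻¹ * N' * (N 0)⁻¹))) := by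
  have hcont : ContinuousAt N 0 :=
    tendsto_pi_nhds.2 fun a => tendsto_pi_nhds.2 fun b => (h a b).continuousAt
  have hdet' : ∀ᶠ t in 𝓝 (0 : ℝ), (N t).det ≠ 0 :=
    (Continuous.matrix_det continuous_id).continuousAt.comp hcont |>.eventually_ne hdet
  have hinv : Tendsto (fun t => (N t)⁻¹) (𝓝[≠] 0) (𝓝 (N 0)⁻¹) := by
    have hc : ContinuousAt (Inv.inv : Matrix n n ℝ → Matrix n n ℝ) (N 0) := by
      refine continuousAt_matrix_inv _ ?_
      simpa [Ring.inverse_eq_inv'] using continuousAt_inv₀ hdet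
    exact (hc.tendsto.comp hcont.tendsto).mono_left nhdsWithin_le_nhds
  have hslope : Tendsto (fun t => t⁻¹ • (N t - N 0)) (𝓝[≠] 0) (𝓝 N') := by
    refine tendsto_pi_nhds.2 fun a => tendsto_pi_nhds.2 fun b => ?_
    simpa [slope_fun_def] using! (hasDerivAt_iff_tendsto_slope.1 (h a b))
  refine ((hinv.mul hslope).mul tendsto_const_nhds).neg.congr' ?_
  filter_upwards [nhdsWithin_le_nhds hdet'] with t ht
  have h1 : (N t)⁻¹ * N t = 1 := Matrix.nonsing_inv_mul _ (isUnit_iff_ne_zero.2 ht)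
  have h2 : N 0 * (N 0)⁻¹ = 1 := Matrix.mul_nonsing_inv _ (isUnit_iff_ne_zero.2 hdet)
  rw [Matrix.mul_smul, Matrix.smul_mul, mul_sub, sub_mul, h1, one_mul, mul_assoc, h2, mul_one,
    ← smul_neg, neg_sub]

lemma hasLineDerivAt_matrix_inv {n : Type*} [Fintype n] [DecidableEq n] {M : E → Matrix n n ℝ}
    {M' : Matrix n n ℝ} (h : ∀ a b, HasLineDerivAt ℝ (fun y => M y a b) (M' a b) x v)
    (hdet : (M x).det ≠ 0) (i j : n) :
    HasLineDerivAt ℝ (fun y => (M y)⁻¹ i j) (-((M x)⁻¹ * M' * (M x)⁻¹) i j) x v := by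
  have := tendsto_inv_slope (N := fun t => M (x + t • v)) h (by simpa using hdet)
  have := (tendsto_pi_nhds.1 ((tendsto_pi_nhds.1 this) i)) j
  refine hasDerivAt_iff_tendsto_slope.2 ?_
  simpa [slope_fun_def] using! this

end LineDeriv

/-! ### Partial derivatives of smooth functions -/

section Partial

variable {n : ℕ} {F : (Fin n → ℝ) → ℝ} {Θ : Set (Fin n → ℝ)} {θ : Fin n → ℝ}

lemma hasLineDerivAt_partialD {m : WithTop ℕ∞} (hm : 1 ≤ m) (hΘ : IsOpen Θ)
    (hF : ContDiffOn ℝ m F Θ) (hθ : θ ∈ Θ) (i : Fin n) :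
    HasLineDerivAt ℝ F (partialD i F θ) θ (Pi.single i 1) :=
  (((hF.contDiffAt (hΘ.mem_nhds hθ)).differentiableAt
    (zero_lt_one.trans_le hm).ne').lineDifferentiableAt).hasLineDerivAt

lemma partialD_eq_fderiv {m : WithTop ℕ∞} (hm : 1 ≤ m) (hΘ : IsOpen Θ)
    (hF : ContDiffOn ℝ m F Θ) (hθ : θ ∈ Θ) (i : Fin n) :
    partialD i F θ = fderiv ℝ F θ (Pi.single i 1) :=
  ((hF.contDiffAt (hΘ.mem_nhds hθ)).differentiableAt
    (zero_lt_one.trans_le hm).ne').lineDeriv_eq_fderiv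

lemma contDiffOn_partialD {m k : WithTop ℕ∞} (hm : m + 1 ≤ k) (hΘ : IsOpen Θ)
    (hF : ContDiffOn ℝ k F Θ) (i : Fin n) : ContDiffOn ℝ m (partialD i F) Θ := by
  refine ContDiffOn.congr ((hF.fderiv_of_isOpen hΘ hm).clm_apply
    (contDiffOn_const (c := Pi.single i (1 : ℝ)))) fun η hη => ?_
  exact partialD_eq_fderiv (le_add_self.trans hm) hΘ hF hη i

lemma partialD_comm (hΘ : IsOpen Θ) (hF : ContDiffOn ℝ 2 F Θ) (hθ : θ ∈ Θ) (i j : Fin n) :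
    partialD i (partialD j F) θ = partialD j (partialD i F) θ := by
  have key : ∀ i j : Fin n, partialD i (partialD j F) θ
      = fderiv ℝ (fderiv ℝ F) θ (Pi.single i 1) (Pi.single j 1) := by
    intro i j
    have h1 : ContDiffOn ℝ 1 (fderiv ℝ F) Θ :=
      hF.fderiv_of_isOpen hΘ (by norm_num [one_add_one_eq_two])
    have hd : DifferentiableAt ℝ (fderiv ℝ F) θ :=
      (h1.contDiffAt (hΘ.mem_nhds hθ)).differentiableAt one_ne_zero
    -- The identification with `fderiv` holds on the open set `Θ`, and a neighbourhood of `θ` is all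
    -- the outer derivative sees.
    have he : partialD j F =ᶠ[𝓝 θ] fun η => fderiv ℝ F η (Pi.single j 1) := by
      filter_upwards [hΘ.mem_nhds hθ] with η hη
      exact partialD_eq_fderiv one_le_two hΘ hF hη j
    unfold partialD at he ⊢
    rw [he.lineDeriv_eq,
      (hd.clm_apply (differentiableAt_const _)).lineDeriv_eq_fderiv, fderiv_clm_apply hd
        (differentiableAt_const _)]
    simp
  rw [key, key]
  exact (hF.contDiffAt (hΘ.mem_nhds hθ)).isSymmSndFDerivAt (by simp) _ _

end Partial

/-! ### Moments of a regular model -/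

section Moments

variable {X : Type*} [MeasurableSpace X] {μ : Measure X} {p : ℕ} {Θ : Set (Fin p → ℝ)}
  {f : X → (Fin p → ℝ) → ℝ} {θ : Fin p → ℝ}

lemma moment_perm {Is Js : List (List (Fin p))} (h : Is.Perm Js) (θ : Fin p → ℝ) :
    moment μ f Is θ = moment μ f Js θ := by
  unfold moment momentIntegrand
  congr 1
  ext x
  rw [(h.map _).prod_eq]

namespace RegularModel

/-- Each partial derivative costs one of the four available orders of smoothness. -/
lemma contDiffOn_logD (hf : RegularModel μ Θ f) (x : X) (I : List (Fin p)) {m : ℕ}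
    (h : m + I.length ≤ 4) : ContDiffOn ℝ m (logD f I x) Θ := by
  induction I generalizing m with
  | nil =>
    have h4 : (m : WithTop ℕ∞) ≤ 4 := by exact_mod_cast h
    exact ((hf.smooth x).of_le h4).log fun η hη => (hf.pos x η hη).ne'
  | cons i I ih =>
    refine contDiffOn_partialD (k := ((m + 1 : ℕ) : WithTop ℕ∞)) (by simp) hf.isOpen
      (ih (m := m + 1) ?_) i
    simp only [List.length_cons] at h
    lia

lemma hasLineDerivAt_logD (hf : RegularModel μ Θ f) (hθ : θ ∈ Θ) (x : X) {I : List (Fin p)}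
    (h : I.length ≤ 3) (s : Fin p) :
    HasLineDerivAt ℝ (logD f I x) (logD f (s :: I) x θ) θ (Pi.single s 1) :=
  hasLineDerivAt_partialD (m := ((1 : ℕ) : WithTop ℕ∞)) (by simp) hf.isOpen
    (hf.contDiffOn_logD x I (by lia)) hθ s

lemma logD_swap (hf : RegularModel μ Θ f) (hθ : θ ∈ Θ) (x : X) {I : List (Fin p)}
    (h : I.length ≤ 2) (i j : Fin p) : logD f (i :: j :: I) x θ = logD f (j :: i :: I) x θ := by
  have := hf.contDiffOn_logD x I (m := 2) (by lia)
  exact partialD_comm hf.isOpen (by exact_mod_cast this) hθ i j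

/-- Near `θ` the density is `exp (log f)`, and `logD f []` is `log f`; the chain rule then gives the
score form `l_s f` at once. -/
lemma hasLineDerivAt_density (hf : RegularModel μ Θ f) (hθ : θ ∈ Θ) (x : X) (s : Fin p) :
    HasLineDerivAt ℝ (f x) (logD f [s] x θ * f x θ) θ (Pi.single s 1) := by
  have h := hf.hasLineDerivAt_logD hθ x (I := []) (by simp) s
  have h' : HasLineDerivAt ℝ (fun η => Real.exp (logD f [] x η)) _ θ (Pi.single s 1) :=
    HasDerivAt.exp h
  have hexp : Real.exp (logD f [] x θ) = f x θ := Real.exp_log (hf.pos x θ hθ)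
  simp only [zero_smul, add_zero, hexp] at h'
  rw [mul_comm]
  refine h'.congr_of_eventuallyEq ?_
  filter_upwards [hf.isOpen.mem_nhds hθ] with η hη
  exact (Real.exp_log (hf.pos x η hη)).symm

lemma partialD_density (hf : RegularModel μ Θ f) (hθ : θ ∈ Θ) (x : X) (s : Fin p) :
    partialD s (f x) θ = logD f [s] x θ * f x θ :=
  (hf.hasLineDerivAt_density hθ x s).lineDeriv

lemma hasLineDerivAt_momentIntegrand_nil (hf : RegularModel μ Θ f) (hθ : θ ∈ Θ) (x : X)
    (s : Fin p) :
    HasLineDerivAt ℝ (momentIntegrand f [] x) (momentIntegrand f [[s]] x θ) θ (Pi.single s 1) := by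
  have e : momentIntegrand f [] x = f x := by
    ext η
    simp [momentIntegrand]
  simpa [e, momentIntegrand] using hf.hasLineDerivAt_density hθ x s

/-- Product rule peeling off one factor; iterating it from the empty product differentiates any
moment integrand. -/
lemma hasLineDerivAt_momentIntegrand_cons (hf : RegularModel μ Θ f) (hθ : θ ∈ Θ) {x : X}
    {s : Fin p} {I : List (Fin p)} (hI : I.length ≤ 3) {Is : List (List (Fin p))} {D : ℝ}
    (h : HasLineDerivAt ℝ (momentIntegrand f Is x) D θ (Pi.single s 1)) :
    HasLineDerivAt ℝ (momentIntegrand f (I :: Is) x)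
      (momentIntegrand f ((s :: I) :: Is) x θ + logD f I x θ * D) θ (Pi.single s 1) := by
  have := hasLineDerivAt_mul (hf.hasLineDerivAt_logD hθ x hI s) h
  have e : momentIntegrand f (I :: Is) x = fun η => logD f I x η * momentIntegrand f Is x η := by
    ext η
    simp only [momentIntegrand, List.map_cons, List.prod_cons, mul_assoc]
  rw [e]
  simpa only [momentIntegrand, List.map_cons, List.prod_cons, mul_assoc] using this

lemma hasLineDerivAt_moment_nil (hf : RegularModel μ Θ f) (hθ : θ ∈ Θ) (s : Fin p) :
    HasLineDerivAt ℝ (moment μ f []) (moment μ f [[s]] θ) θ (Pi.single s 1) := by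
  have h := hf.exchange [] (by simp) (by simp) θ hθ s
  have e : ∀ x, partialD s (momentIntegrand f [] x) θ = momentIntegrand f [[s]] x θ :=
    fun x => (hf.hasLineDerivAt_momentIntegrand_nil hθ x s).lineDeriv
  simp only [e] at h
  exact h

/-- After the exchange, the derivative either lengthens a multi-index by `s` or hits the density,
which contributes a new factor `l_s`. The resulting products have order at most four, so each is
integrable separately and the integral splits. The versions with two and three factors work the same
way. -/
lemma hasLineDerivAt_moment_one (hf : RegularModel μ Θ f) (hθ : θ ∈ Θ) {A : List (Fin p)}
    (hA : A ≠ []) (hl : A.length ≤ 3) (s : Fin p) :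
    HasLineDerivAt ℝ (moment μ f [A]) (moment μ f [s :: A] θ + moment μ f [A, [s]] θ) θ
      (Pi.single s 1) := by
  have h := hf.exchange [A] (by simpa using hA) (by simpa using hl) θ hθ s
  have e : ∀ x, partialD s (momentIntegrand f [A] x) θ
      = momentIntegrand f [s :: A] x θ + momentIntegrand f [A, [s]] x θ := by
    intro x
    refine (hf.hasLineDerivAt_momentIntegrand_cons hθ hl
      (hf.hasLineDerivAt_momentIntegrand_nil hθ x s)).lineDeriv.trans ?_
    simp only [momentIntegrand, List.map_cons, List.map_nil, List.prod_cons, List.prod_nil]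
    ring
  simp only [e] at h
  rwa [integral_add] at h
  · exact hf.finite_moment _ (by simp) (by simp; lia) θ hθ
  · exact hf.finite_moment _ (by simp [hA]) (by simp; lia) θ hθ

lemma hasLineDerivAt_moment_two (hf : RegularModel μ Θ f) (hθ : θ ∈ Θ) {A B : List (Fin p)}
    (hA : A ≠ []) (hB : B ≠ []) (hl : A.length + B.length ≤ 3) (s : Fin p) :
    HasLineDerivAt ℝ (moment μ f [A, B])
      (moment μ f [s :: A, B] θ + moment μ f [A, s :: B] θ + moment μ f [A, B, [s]] θ) θ
      (Pi.single s 1) := by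
  have h := hf.exchange [A, B] (by simp [hA, hB]) (by simpa using hl) θ hθ s
  have e : ∀ x, partialD s (momentIntegrand f [A, B] x) θ
      = momentIntegrand f [s :: A, B] x θ + momentIntegrand f [A, s :: B] x θ
        + momentIntegrand f [A, B, [s]] x θ := by
    intro x
    refine (hf.hasLineDerivAt_momentIntegrand_cons hθ (by lia)
      (hf.hasLineDerivAt_momentIntegrand_cons hθ (by lia)
        (hf.hasLineDerivAt_momentIntegrand_nil hθ x s))).lineDeriv.trans ?_
    simp only [momentIntegrand, List.map_cons, List.map_nil, List.prod_cons, List.prod_nil]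
    ring
  have i1 := hf.finite_moment [s :: A, B] (by simp [hB]) (by simp; lia) θ hθ
  have i2 := hf.finite_moment [A, s :: B] (by simp [hA]) (by simp; lia) θ hθ
  have i3 := hf.finite_moment [A, B, [s]] (by simp [hA, hB]) (by simp; lia) θ hθ
  simp only [e] at h
  rwa [integral_add (i1.fun_add i2) i3, integral_add i1 i2] at h

lemma hasLineDerivAt_moment_three (hf : RegularModel μ Θ f) (hθ : θ ∈ Θ)
    {A B C : List (Fin p)} (hA : A ≠ []) (hB : B ≠ []) (hC : C ≠ [])
    (hl : A.length + B.length + C.length ≤ 3) (s : Fin p) :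
    HasLineDerivAt ℝ (moment μ f [A, B, C])
      (moment μ f [s :: A, B, C] θ + moment μ f [A, s :: B, C] θ + moment μ f [A, B, s :: C] θ
        + moment μ f [A, B, C, [s]] θ) θ (Pi.single s 1) := by
  have h := hf.exchange [A, B, C] (by simp [hA, hB, hC]) (by simp; lia) θ hθ s
  have e : ∀ x, partialD s (momentIntegrand f [A, B, C] x) θ
      = momentIntegrand f [s :: A, B, C] x θ + momentIntegrand f [A, s :: B, C] x θ
        + momentIntegrand f [A, B, s :: C] x θ + momentIntegrand f [A, B, C, [s]] x θ := by
    intro x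
    refine (hf.hasLineDerivAt_momentIntegrand_cons hθ (by lia)
      (hf.hasLineDerivAt_momentIntegrand_cons hθ (by lia)
        (hf.hasLineDerivAt_momentIntegrand_cons hθ (by lia)
          (hf.hasLineDerivAt_momentIntegrand_nil hθ x s)))).lineDeriv.trans ?_
    simp only [momentIntegrand, List.map_cons, List.map_nil, List.prod_cons, List.prod_nil]
    ring
  have i1 := hf.finite_moment [s :: A, B, C] (by simp [hB, hC]) (by simp; lia) θ hθ
  have i2 := hf.finite_moment [A, s :: B, C] (by simp [hA, hC]) (by simp; lia) θ hθ
  have i3 := hf.finite_moment [A, B, s :: C] (by simp [hA, hB]) (by simp; lia) θ hθ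
  have i4 := hf.finite_moment [A, B, C, [s]] (by simp [hA, hB, hC]) (by simp; lia) θ hθ
  simp only [e] at h
  rwa [integral_add ((i1.fun_add i2).fun_add i3) i4, integral_add (i1.fun_add i2) i3,
    integral_add i1 i2] at h

lemma moment_nil (hf : RegularModel μ Θ f) (hθ : θ ∈ Θ) : moment μ f [] θ = 1 := by
  simpa [moment, momentIntegrand] using hf.density θ hθ

lemma moment_score (hf : RegularModel μ Θ f) (hθ : θ ∈ Θ) (i : Fin p) :
    moment μ f [[i]] θ = 0 := by
  refine (hf.hasLineDerivAt_moment_nil hθ i).unique ?_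
  refine HasLineDerivAt.congr_of_eventuallyEq (f := fun _ => (1 : ℝ)) (hasDerivAt_const _ _) ?_
  filter_upwards [hf.isOpen.mem_nhds hθ] with η hη using hf.moment_nil hη

/-- Differentiate `E[l_j] = 0`, itself the derivative of the normalisation `∫ f dμ = 1`. -/
lemma moment_hessian (hf : RegularModel μ Θ f) (hθ : θ ∈ Θ) (i j : Fin p) :
    moment μ f [[i, j]] θ = -moment μ f [[i], [j]] θ := by
  have h : moment μ f [[i, j]] θ + moment μ f [[j], [i]] θ = 0 := by
    refine (hf.hasLineDerivAt_moment_one hθ (A := [j]) (by simp) (by simp) i).unique ?_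
    refine HasLineDerivAt.congr_of_eventuallyEq (f := fun _ => (0 : ℝ)) (hasDerivAt_const _ _) ?_
    filter_upwards [hf.isOpen.mem_nhds hθ] with η hη using hf.moment_score hη j
  rw [moment_perm (List.Perm.swap [j] [i] [])]
  linarith

lemma moment_swap (hf : RegularModel μ Θ f) (hθ : θ ∈ Θ) {I : List (Fin p)} (h : I.length ≤ 2)
    (Is : List (List (Fin p))) (i j : Fin p) :
    moment μ f ((i :: j :: I) :: Is) θ = moment μ f ((j :: i :: I) :: Is) θ := by
  simp only [moment, momentIntegrand, List.map_cons, hf.logD_swap hθ _ h i j]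

end RegularModel

end Moments

/-! ### Weighted integrals that exist -/

/-- The integral `∫ u w dμ` exists and equals `c`. -/
def HasMean {X : Type*} [MeasurableSpace X] (μ : Measure X) (w u : X → ℝ) (c : ℝ) : Prop :=
  Integrable (fun x => u x * w x) μ ∧ ∫ x, u x * w x ∂μ = c

namespace HasMean

variable {X : Type*} [MeasurableSpace X] {μ : Measure X} {w u v : X → ℝ} {c d : ℝ}

lemma add (hu : HasMean μ w u c) (hv : HasMean μ w v d) :
    HasMean μ w (fun x => u x + v x) (c + d) := by
  simp only [HasMean, add_mul]
  exact ⟨hu.1.fun_add hv.1, by rw [integral_add hu.1 hv.1, hu.2, hv.2]⟩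

lemma sub (hu : HasMean μ w u c) (hv : HasMean μ w v d) :
    HasMean μ w (fun x => u x - v x) (c - d) := by
  simp only [HasMean, sub_mul]
  exact ⟨hu.1.sub hv.1, by rw [integral_sub hu.1 hv.1, hu.2, hv.2]⟩

lemma const_mul (a : ℝ) (hu : HasMean μ w u c) : HasMean μ w (fun x => a * u x) (a * c) := by
  simp only [HasMean, mul_assoc]
  exact ⟨hu.1.const_mul a, by rw [integral_const_mul, hu.2]⟩

lemma sum {ι : Type*} {s : Finset ι} {u : ι → X → ℝ} {c : ι → ℝ}
    (h : ∀ i ∈ s, HasMean μ w (u i) (c i)) :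
    HasMean μ w (fun x => ∑ i ∈ s, u i x) (∑ i ∈ s, c i) := by
  simp only [HasMean, Finset.sum_mul]
  refine ⟨integrable_finsetSum _ fun i hi => (h i hi).1, ?_⟩
  rw [integral_finsetSum _ fun i hi => (h i hi).1]
  exact Finset.sum_congr rfl fun i hi => (h i hi).2

lemma congr (hu : HasMean μ w u c) (huv : ∀ x, v x = u x) (hcd : d = c) : HasMean μ w v d := by
  obtain rfl := hcd
  rwa [show v = u from funext huv]

/-- The mean of the product of the residuals of `A` and `B` after projection onto the span of `1`
and the centred functions `l t`. -/
lemma residual_mul {n : Type*} [Fintype n] [DecidableEq n] {A B : X → ℝ} {l : n → X → ℝ}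
    {G : Matrix n n ℝ} (hG : IsUnit G.det) {a b ab : ℝ} {ca cb : n → ℝ}
    (h1 : HasMean μ w (fun _ => 1) 1) (hl : ∀ t, HasMean μ w (l t) 0)
    (hll : ∀ s t, HasMean μ w (fun x => l s x * l t x) (G s t))
    (hA : HasMean μ w A a) (hB : HasMean μ w B b) (hAB : HasMean μ w (fun x => A x * B x) ab)
    (hAl : ∀ t, HasMean μ w (fun x => A x * l t x) (ca t))
    (hBl : ∀ t, HasMean μ w (fun x => B x * l t x) (cb t)) :
    HasMean μ w (fun x => (A x - a - ∑ s, ∑ t, ca s * G⁻¹ s t * l t x)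
        * (B x - b - ∑ s, ∑ t, cb s * G⁻¹ s t * l t x))
      (ab - a * b - ∑ s, ∑ t, ca s * G⁻¹ s t * cb t) := by
  set e : n → ℝ := fun t => ∑ s, ca s * G⁻¹ s t with he
  set d : n → ℝ := fun t => ∑ s, cb s * G⁻¹ s t with hd
  have heG : ∀ u, ∑ t, e t * G t u = ca u := by
    intro u
    have : Matrix.vecMul (Matrix.vecMul ca G⁻¹) G = ca := by
      rw [Matrix.vecMul_vecMul, Matrix.nonsing_inv_mul _ hG, Matrix.vecMul_one]
    exact congrFun this u
  have hes : ∀ (c : n → ℝ) (y : n → ℝ),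
      ∑ s, ∑ t, c s * G⁻¹ s t * y t = ∑ t, (∑ s, c s * G⁻¹ s t) * y t := by
    intro c y
    rw [Finset.sum_comm]
    simp only [Finset.sum_mul]
  -- The first residual is orthogonal to `1` (`h0`) and, by `heG`, to every `l u` (`hu`). So in its
  -- product with the second residual only its pairing with `B` survives (`hb`).
  have h0 : HasMean μ w (fun x => A x - a * 1 - ∑ t, e t * l t x) (a - a * 1 - ∑ t, e t * 0) :=
    (hA.sub (h1.const_mul a)).sub (sum fun t _ => (hl t).const_mul (e t))
  have hu : ∀ u, HasMean μ w
      (fun x => A x * l u x - a * l u x - ∑ t, e t * (l t x * l u x))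
      (ca u - a * 0 - ∑ t, e t * G t u) := fun u =>
    ((hAl u).sub ((hl u).const_mul a)).sub (sum fun t _ => (hll t u).const_mul (e t))
  have hb : HasMean μ w (fun x => A x * B x - a * B x - ∑ t, e t * (B x * l t x))
      (ab - a * b - ∑ t, e t * cb t) :=
    (hAB.sub (hB.const_mul a)).sub (sum fun t _ => (hBl t).const_mul (e t))
  refine ((hb.sub (h0.const_mul b)).sub (sum (s := Finset.univ)
    fun u _ => (hu u).const_mul (d u))).congr (fun x => ?_) ?_
  · rw [hes, hes]
    have e1 : ∑ u, d u * (A x * l u x - a * l u x - ∑ t, e t * (l t x * l u x))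
        = (A x - a - ∑ t, e t * l t x) * ∑ u, d u * l u x := by
      rw [Finset.mul_sum]
      refine Finset.sum_congr rfl fun u _ => ?_
      simp only [← mul_assoc, ← Finset.sum_mul]
      ring
    have e2 : ∑ t, e t * (B x * l t x) = B x * ∑ t, e t * l t x := by
      rw [Finset.mul_sum]
      exact Finset.sum_congr rfl fun t _ => by ring
    rw [e1, e2]
    ring
  · simp only [heG, hes]
    simp [he]

end HasMean

/-! ### Geometry of the scale extension -/

section Geometry

variable {X : Type*} {p : ℕ}

lemma basePt_zero (θ : Fin p → ℝ) : basePt θ 0 = 0 := rfl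

lemma basePt_succ (θ : Fin p → ℝ) (i : Fin p) : basePt θ i.succ = θ i := rfl

lemma scaleExt_basePt (f : X → (Fin p → ℝ) → ℝ) (x : X) (θ : Fin p → ℝ) :
    scaleExt f x (basePt θ) = f x θ := by
  simp [scaleExt, basePt]

lemma coordVec_scaleExt_zero (f : X → (Fin p → ℝ) → ℝ) (θ : Fin p → ℝ) (x : X) :
    coordVec (scaleExt f) 0 (basePt θ) x = f x θ := by
  refine HasLineDerivAt.lineDeriv ?_
  have : HasDerivAt (fun t : ℝ => Real.exp t * f x θ) (Real.exp 0 * f x θ) 0 :=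
    (Real.hasDerivAt_exp 0).mul_const _
  simpa [HasLineDerivAt, scaleExt, basePt] using this

/-- A move along `θ^j` fixes `θ⁰`, so the scale factor is a constant that leaves the derivative; no
regularity of `f` is involved. -/
lemma coordVec_scaleExt_succ (f : X → (Fin p → ℝ) → ℝ) (j : Fin p) (η : Fin (p + 1) → ℝ) (x : X) :
    coordVec (scaleExt f) j.succ η x
      = Real.exp (η 0) * partialD j (f x) (fun i => η i.succ) := by
  simp only [coordVec, partialD, lineDeriv, scaleExt]
  rw [← deriv_const_mul_field]
  congr 1
  ext t
  have h : (fun i : Fin p => (η + t • (Pi.single j.succ 1 : Fin (p + 1) → ℝ)) i.succ)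
      = (fun i => η i.succ) + t • (Pi.single j 1 : Fin p → ℝ) := by
    ext i
    simp [Pi.single_apply]
  rw [h]
  simp [(Fin.succ_ne_zero j).symm]

variable [MeasurableSpace X] {μ : Measure X} {Θ : Set (Fin p → ℝ)}
  {f : X → (Fin p → ℝ) → ℝ} {θ : Fin p → ℝ}

namespace RegularModel

lemma hasMean_moment (hf : RegularModel μ Θ f) (hθ : θ ∈ Θ) (Is : List (List (Fin p)))
    (h : ∀ I ∈ Is, I ≠ []) (hl : (Is.map List.length).sum ≤ 4) :
    HasMean μ (fun x => f x θ) (fun x => (Is.map fun I => logD f I x θ).prod)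
      (moment μ f Is θ) :=
  ⟨hf.finite_moment Is h hl θ hθ, rfl⟩

lemma innerIntegrand_mul_density (hf : RegularModel μ Θ f) (hθ : θ ∈ Θ) (u v : X → ℝ) :
    innerIntegrand (fun x => f x θ) (fun x => u x * f x θ) (fun x => v x * f x θ)
      = fun x => (u x * v x) * f x θ := by
  ext x
  have := (hf.pos x θ hθ).ne'
  simp only [innerIntegrand]
  field_simp

/-- The dictionary from geometry to moments: existence and value of an ambient inner product are
read off from a weighted mean of the factors in front of the density. -/
lemma integrable_and_ambientInner (hf : RegularModel μ Θ f) (hθ : θ ∈ Θ) {u v a b : X → ℝ} {c : ℝ}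
    (h : HasMean μ (fun x => f x θ) (fun x => u x * v x) c) (ha : ∀ x, a x = u x * f x θ)
    (hb : ∀ x, b x = v x * f x θ) :
    Integrable (innerIntegrand (fun x => f x θ) a b) μ ∧
      ambientInner μ (fun x => f x θ) a b = c := by
  rw [funext ha, funext hb, ambientInner, hf.innerIntegrand_mul_density hθ]
  exact h

lemma metric_eq (hf : RegularModel μ Θ f) (hθ : θ ∈ Θ) (i j : Fin p) :
    metric μ f θ i j = moment μ f [[i], [j]] θ :=
  (hf.integrable_and_ambientInner hθ
    ((hf.hasMean_moment hθ [[i], [j]] (by simp) (by simp)).congr (fun x => by simp) rfl)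
    (fun x => hf.partialD_density hθ x i) (fun x => hf.partialD_density hθ x j)).2

lemma coordVec_scaleExt_basePt (hf : RegularModel μ Θ f) (hθ : θ ∈ Θ) (j : Fin p) (x : X) :
    coordVec (scaleExt f) j.succ (basePt θ) x = logD f [j] x θ * f x θ := by
  rw [coordVec_scaleExt_succ, ← hf.partialD_density hθ]
  simp [basePt]

/-- The `α`-representation of `∂_j` is `f^{(1-α)/2} l_j`. Its `∂_i`-derivative is `f^{(1-α)/2} (l_ij
+ (1-α)/2 * l_i l_j)`, and returning from the representation multiplies by `f^{(1+α)/2}`, which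
restores the full power of `f`. -/
lemma ambientCov_scaleExt (hf : RegularModel μ Θ f) (hθ : θ ∈ Θ) (α : ℝ) (i j : Fin p) (x : X) :
    ambientCov α (scaleExt f) i.succ (coordVec (scaleExt f) j.succ) (basePt θ) x
      = (logD f [i, j] x θ + (1 - α) / 2 * (logD f [i] x θ * logD f [j] x θ)) * f x θ := by
  have hpos := hf.pos x θ hθ
  have hd := hf.hasLineDerivAt_density hθ x i
  have hD : HasLineDerivAt ℝ (fun η => f x η ^ (-(1 + α) / 2) * (logD f [j] x η * f x η))
      _ θ (Pi.single i 1) :=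
    hasLineDerivAt_mul (HasDerivAt.rpow_const hd (Or.inl (by simpa using hpos.ne')))
      (hasLineDerivAt_mul (hf.hasLineDerivAt_logD hθ x (I := [j]) (by simp) i) hd)
  have hD' := hD.congr_of_eventuallyEq
    (f₁ := fun η => f x η ^ (-(1 + α) / 2) * partialD j (f x) η) (by
      filter_upwards [hf.isOpen.mem_nhds hθ] with η hη
      rw [hf.partialD_density hη])
  -- The line through `(0, θ)` in direction `i.succ` stays in the slice `θ⁰ = 0`, where the
  -- extension is `f` itself.
  have hline : partialD i.succ (fun η => alphaRep α (fun y => scaleExt f y η)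
      (coordVec (scaleExt f) j.succ η) x) (basePt θ)
      = partialD i (fun η => f x η ^ (-(1 + α) / 2) * partialD j (f x) η) θ := by
    simp only [partialD, lineDeriv]
    congr 1
    ext t
    have h : basePt θ + t • (Pi.single i.succ 1 : Fin (p + 1) → ℝ)
        = basePt (θ + t • (Pi.single i 1 : Fin p → ℝ)) := by
      ext k
      refine Fin.cases ?_ (fun k => ?_) k
      · simp [basePt, (Fin.succ_ne_zero i).symm]
      · simp [basePt, Pi.single_apply]
    rw [h, alphaRep, scaleExt_basePt, coordVec_scaleExt_succ]
    simp only [basePt_zero, basePt_succ, Real.exp_zero, one_mul]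
    rfl
  rw [ambientCov, ofAlphaRep, hline, scaleExt_basePt]
  unfold partialD at hD' ⊢
  rw [hD'.lineDeriv]
  simp only [zero_smul, add_zero]
  rw [Real.rpow_sub_one hpos.ne']
  -- The only fact needed about the two real powers is that they are inverse to each other; they are
  -- then generalised to make the goal polynomial.
  have h1 : f x θ ^ ((1 + α) / 2) * f x θ ^ (-(1 + α) / 2) = 1 := by
    rw [← Real.rpow_add hpos, neg_div, add_neg_cancel, Real.rpow_zero]
  generalize f x θ ^ ((1 + α) / 2) = P at *
  generalize f x θ ^ (-(1 + α) / 2) = Q at *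
  have hne := hpos.ne'
  field_simp
  linear_combination
    (2 * logD f [i, j] x θ + (1 - α) * logD f [i] x θ * logD f [j] x θ) * h1

end RegularModel

end Geometry

section Model

variable {X : Type*} [MeasurableSpace X] {μ : Measure X} {p : ℕ} {Θ : Set (Fin p → ℝ)}
  {f : X → (Fin p → ℝ) → ℝ} {θ : Fin p → ℝ}

namespace RegularModel

/-! ### The metric and its inverse -/

lemma det_metric_ne_zero (hf : RegularModel μ Θ f) (hθ : θ ∈ Θ) : (metric μ f θ).det ≠ 0 :=
  (hf.metric_posDef θ hθ).det_pos.ne'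

lemma metric_comm (hf : RegularModel μ Θ f) (hθ : θ ∈ Θ) (i j : Fin p) :
    metric μ f θ i j = metric μ f θ j i := by
  rw [hf.metric_eq hθ, hf.metric_eq hθ, moment_perm (List.Perm.swap [j] [i] [])]

lemma gInv_comm (hf : RegularModel μ Θ f) (hθ : θ ∈ Θ) (i j : Fin p) :
    gInv μ f θ i j = gInv μ f θ j i := by
  have h : (metric μ f θ).transpose = metric μ f θ := by
    ext i j
    exact hf.metric_comm hθ j i
  change (metric μ f θ)⁻¹ i j = (metric μ f θ)⁻¹.transpose i j
  rw [Matrix.transpose_nonsing_inv, h]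

/-- This is the duality of the two connections, `∂_s g_ij = Γ^e_{si,j} + Γ^m_{sj,i}`, in terms of
moments. -/
lemma hasLineDerivAt_metric (hf : RegularModel μ Θ f) (hθ : θ ∈ Θ) (s i j : Fin p) :
    HasLineDerivAt ℝ (fun η => metric μ f η i j)
      (moment μ f [[s, i], [j]] θ + moment μ f [[s, j], [i]] θ + moment μ f [[s], [i], [j]] θ) θ
      (Pi.single s 1) := by
  have h := hf.hasLineDerivAt_moment_two hθ (A := [i]) (B := [j]) (by simp) (by simp) (by simp) s
  have e1 : moment μ f [[i], [s, j]] θ = moment μ f [[s, j], [i]] θ :=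
    moment_perm (List.Perm.swap _ _ _) θ
  have e2 : moment μ f [[i], [j], [s]] θ = moment μ f [[s], [i], [j]] θ :=
    moment_perm (List.perm_append_comm (l₁ := [[i], [j]]) (l₂ := [[s]])) θ
  rw [e1, e2] at h
  refine h.congr_of_eventuallyEq ?_
  filter_upwards [hf.isOpen.mem_nhds hθ] with η hη using hf.metric_eq hη i j

lemma hasLineDerivAt_gInv (hf : RegularModel μ Θ f) (hθ : θ ∈ Θ) (s i j : Fin p) :
    HasLineDerivAt ℝ (fun η => gInv μ f η i j)
      (-∑ a, ∑ b, gInv μ f θ i a * gInv μ f θ b j *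
        (moment μ f [[s, a], [b]] θ + moment μ f [[s, b], [a]] θ + moment μ f [[s], [a], [b]] θ))
      θ (Pi.single s 1) := by
  convert! hasLineDerivAt_matrix_inv (M := metric μ f) (M' := Matrix.of fun a b =>
    moment μ f [[s, a], [b]] θ + moment μ f [[s, b], [a]] θ + moment μ f [[s], [a], [b]] θ)
    (hf.hasLineDerivAt_metric hθ s) (hf.det_metric_ne_zero hθ) i j using 2
  simp only [Matrix.mul_apply, Finset.sum_mul, Matrix.of_apply]
  rw [Finset.sum_comm]
  refine Finset.sum_congr rfl fun b _ => Finset.sum_congr rfl fun a _ => ?_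
  change gInv μ f θ i a * gInv μ f θ b j * _ = gInv μ f θ i a * _ * gInv μ f θ b j
  ring

/-! ### Inner products along the scale extension -/

lemma hasMean_one (hf : RegularModel μ Θ f) (hθ : θ ∈ Θ) :
    HasMean μ (fun x => f x θ) (fun _ => 1) 1 :=
  (hf.hasMean_moment hθ [] (by simp) (by simp)).congr (fun x => by simp) (hf.moment_nil hθ).symm

lemma hasMean_score (hf : RegularModel μ Θ f) (hθ : θ ∈ Θ) (i : Fin p) :
    HasMean μ (fun x => f x θ) (fun x => logD f [i] x θ) 0 :=
  (hf.hasMean_moment hθ [[i]] (by simp) (by simp)).congr (fun x => by simp)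
    (hf.moment_score hθ i).symm

lemma hasMean_score_mul (hf : RegularModel μ Θ f) (hθ : θ ∈ Θ) (i j : Fin p) :
    HasMean μ (fun x => f x θ) (fun x => logD f [i] x θ * logD f [j] x θ) (metric μ f θ i j) :=
  (hf.hasMean_moment hθ [[i], [j]] (by simp) (by simp)).congr (fun x => by simp)
    (hf.metric_eq hθ i j)

lemma hasMean_cov (hf : RegularModel μ Θ f) (hθ : θ ∈ Θ) (a : ℝ) (i j : Fin p) :
    HasMean μ (fun x => f x θ)
      (fun x => logD f [i, j] x θ + a * (logD f [i] x θ * logD f [j] x θ))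
      (moment μ f [[i, j]] θ + a * moment μ f [[i], [j]] θ) :=
  ((hf.hasMean_moment hθ [[i, j]] (by simp) (by simp)).add
    ((hf.hasMean_moment hθ [[i], [j]] (by simp) (by simp)).const_mul a)).congr
    (fun x => by simp) rfl

lemma hasMean_cov_mul_score (hf : RegularModel μ Θ f) (hθ : θ ∈ Θ) (a : ℝ) (i j k : Fin p) :
    HasMean μ (fun x => f x θ)
      (fun x => (logD f [i, j] x θ + a * (logD f [i] x θ * logD f [j] x θ)) * logD f [k] x θ)
      (moment μ f [[i, j], [k]] θ + a * moment μ f [[i], [j], [k]] θ) :=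
  ((hf.hasMean_moment hθ [[i, j], [k]] (by simp) (by simp)).add
    ((hf.hasMean_moment hθ [[i], [j], [k]] (by simp) (by simp)).const_mul a)).congr
    (fun x => by simp; ring) rfl

lemma hasMean_hessian_mul_cov (hf : RegularModel μ Θ f) (hθ : θ ∈ Θ) (a : ℝ) (i j k l : Fin p) :
    HasMean μ (fun x => f x θ)
      (fun x => logD f [i, j] x θ * (logD f [k, l] x θ + a * (logD f [k] x θ * logD f [l] x θ)))
      (moment μ f [[i, j], [k, l]] θ + a * moment μ f [[i, j], [k], [l]] θ) :=
  ((hf.hasMean_moment hθ [[i, j], [k, l]] (by simp) (by simp)).add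
    ((hf.hasMean_moment hθ [[i, j], [k], [l]] (by simp) (by simp)).const_mul a)).congr
    (fun x => by simp; ring) rfl

lemma inner_coordVec_zero_zero (hf : RegularModel μ Θ f) (hθ : θ ∈ Θ) :
    Integrable (innerIntegrand (fun x => f x θ) (coordVec (scaleExt f) 0 (basePt θ))
        (coordVec (scaleExt f) 0 (basePt θ))) μ ∧
      ambientInner μ (fun x => f x θ) (coordVec (scaleExt f) 0 (basePt θ))
        (coordVec (scaleExt f) 0 (basePt θ)) = 1 :=
  hf.integrable_and_ambientInner hθ (u := fun _ => 1) (v := fun _ => 1)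
    ((hf.hasMean_one hθ).congr (fun x => by simp) rfl)
    (fun x => by simp [coordVec_scaleExt_zero]) (fun x => by simp [coordVec_scaleExt_zero])

lemma inner_coordVec_succ_zero (hf : RegularModel μ Θ f) (hθ : θ ∈ Θ) (i : Fin p) :
    Integrable (innerIntegrand (fun x => f x θ) (coordVec (scaleExt f) i.succ (basePt θ))
        (coordVec (scaleExt f) 0 (basePt θ))) μ ∧
      ambientInner μ (fun x => f x θ) (coordVec (scaleExt f) i.succ (basePt θ))
        (coordVec (scaleExt f) 0 (basePt θ)) = 0 :=
  hf.integrable_and_ambientInner hθ (u := fun x => logD f [i] x θ) (v := fun _ => 1)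
    ((hf.hasMean_score hθ i).congr (fun x => by simp) rfl)
    (fun x => hf.coordVec_scaleExt_basePt hθ i x) (fun x => by simp [coordVec_scaleExt_zero])

lemma inner_coordVec_zero_succ (hf : RegularModel μ Θ f) (hθ : θ ∈ Θ) (i : Fin p) :
    Integrable (innerIntegrand (fun x => f x θ) (coordVec (scaleExt f) 0 (basePt θ))
        (coordVec (scaleExt f) i.succ (basePt θ))) μ ∧
      ambientInner μ (fun x => f x θ) (coordVec (scaleExt f) 0 (basePt θ))
        (coordVec (scaleExt f) i.succ (basePt θ)) = 0 :=
  hf.integrable_and_ambientInner hθ (u := fun _ => 1) (v := fun x => logD f [i] x θ)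
    ((hf.hasMean_score hθ i).congr (fun x => by simp) rfl)
    (fun x => by simp [coordVec_scaleExt_zero]) (fun x => hf.coordVec_scaleExt_basePt hθ i x)

lemma inner_coordVec_succ_succ (hf : RegularModel μ Θ f) (hθ : θ ∈ Θ) (i j : Fin p) :
    Integrable (innerIntegrand (fun x => f x θ) (coordVec (scaleExt f) i.succ (basePt θ))
        (coordVec (scaleExt f) j.succ (basePt θ))) μ ∧
      ambientInner μ (fun x => f x θ) (coordVec (scaleExt f) i.succ (basePt θ))
        (coordVec (scaleExt f) j.succ (basePt θ)) = metric μ f θ i j :=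
  hf.integrable_and_ambientInner hθ (hf.hasMean_score_mul hθ i j)
    (fun x => hf.coordVec_scaleExt_basePt hθ i x) (fun x => hf.coordVec_scaleExt_basePt hθ j x)

lemma inner_ambientCov_zero (hf : RegularModel μ Θ f) (hθ : θ ∈ Θ) (α : ℝ) (i j : Fin p) :
    Integrable (innerIntegrand (fun x => f x θ)
        (ambientCov α (scaleExt f) i.succ (coordVec (scaleExt f) j.succ) (basePt θ))
        (coordVec (scaleExt f) 0 (basePt θ))) μ ∧
      ambientInner μ (fun x => f x θ)
        (ambientCov α (scaleExt f) i.succ (coordVec (scaleExt f) j.succ) (basePt θ))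
        (coordVec (scaleExt f) 0 (basePt θ))
        = moment μ f [[i, j]] θ + (1 - α) / 2 * moment μ f [[i], [j]] θ :=
  hf.integrable_and_ambientInner hθ (v := fun _ => 1)
    ((hf.hasMean_cov hθ ((1 - α) / 2) i j).congr (fun x => mul_one _) rfl)
    (hf.ambientCov_scaleExt hθ α i j) (fun x => by simp [coordVec_scaleExt_zero])

lemma inner_ambientCov_succ (hf : RegularModel μ Θ f) (hθ : θ ∈ Θ) (α : ℝ) (i j k : Fin p) :
    Integrable (innerIntegrand (fun x => f x θ)
        (ambientCov α (scaleExt f) i.succ (coordVec (scaleExt f) j.succ) (basePt θ))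
        (coordVec (scaleExt f) k.succ (basePt θ))) μ ∧
      ambientInner μ (fun x => f x θ)
        (ambientCov α (scaleExt f) i.succ (coordVec (scaleExt f) j.succ) (basePt θ))
        (coordVec (scaleExt f) k.succ (basePt θ))
        = moment μ f [[i, j], [k]] θ + (1 - α) / 2 * moment μ f [[i], [j], [k]] θ :=
  hf.integrable_and_ambientInner hθ (hf.hasMean_cov_mul_score hθ ((1 - α) / 2) i j k)
    (hf.ambientCov_scaleExt hθ α i j) (hf.coordVec_scaleExt_basePt hθ k)

lemma integrable_inner_coordVec (hf : RegularModel μ Θ f) (hθ : θ ∈ Θ) (i j : Fin (p + 1)) :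
    Integrable (innerIntegrand (fun x => f x θ) (coordVec (scaleExt f) i (basePt θ))
      (coordVec (scaleExt f) j (basePt θ))) μ := by
  refine Fin.cases ?_ (fun i => ?_) i <;> refine Fin.cases ?_ (fun j => ?_) j
  · exact (hf.inner_coordVec_zero_zero hθ).1
  · exact (hf.inner_coordVec_zero_succ hθ j).1
  · exact (hf.inner_coordVec_succ_zero hθ i).1
  · exact (hf.inner_coordVec_succ_succ hθ i j).1

lemma integrable_inner_ambientCov (hf : RegularModel μ Θ f) (hθ : θ ∈ Θ) (α : ℝ) (i j : Fin p)
    (k : Fin (p + 1)) :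
    Integrable (innerIntegrand (fun x => f x θ)
      (ambientCov α (scaleExt f) i.succ (coordVec (scaleExt f) j.succ) (basePt θ))
      (coordVec (scaleExt f) k (basePt θ))) μ := by
  refine Fin.cases ?_ (fun k => ?_) k
  · exact (hf.inner_ambientCov_zero hθ α i j).1
  · exact (hf.inner_ambientCov_succ hθ α i j k).1

lemma Gam_eq (hf : RegularModel μ Θ f) (hθ : θ ∈ Θ) (α : ℝ) (i j k : Fin p) :
    Gam μ α f i j k θ = moment μ f [[i, j], [k]] θ
      + (1 - α) / 2 * moment μ f [[i], [j], [k]] θ := by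
  simp only [Gam, christoffelFamily, scaleExt_basePt]
  exact (hf.inner_ambientCov_succ hθ α i j k).2

lemma T3_eq (hf : RegularModel μ Θ f) (hθ : θ ∈ Θ) (i j k : Fin p) :
    T3 μ f i j k θ = moment μ f [[i], [j], [k]] θ := by
  rw [T3, hf.Gam_eq hθ, hf.Gam_eq hθ]
  ring

/-! ### The second fundamental form -/

/-- `∂_0` is a unit vector, and it is orthogonal to each `∂_i` because scores have mean zero; the
metric is block diagonal and inverts blockwise. -/
lemma metric_scaleExt_inv (hf : RegularModel μ Θ f) (hθ : θ ∈ Θ) :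
    (metric μ (scaleExt f) (basePt θ))⁻¹
      = Matrix.of (Fin.cons (Fin.cons 1 0) fun i => Fin.cons 0 (gInv μ f θ i)) := by
  refine Matrix.inv_eq_right_inv ?_
  have h : ∀ i j, metric μ (scaleExt f) (basePt θ) i j = ambientInner μ (fun x => f x θ)
      (coordVec (scaleExt f) i (basePt θ)) (coordVec (scaleExt f) j (basePt θ)) := by
    intro i j
    simp only [metric, Matrix.of_apply, scaleExt_basePt]
  ext i j
  have hmul : (metric μ f θ * gInv μ f θ) = 1 :=
    Matrix.mul_nonsing_inv _ (isUnit_iff_ne_zero.2 (hf.det_metric_ne_zero hθ))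
  rw [Matrix.mul_apply, Fin.sum_univ_succ]
  simp only [h]
  refine Fin.cases ?_ (fun i => ?_) i <;> refine Fin.cases ?_ (fun j => ?_) j
  · simp [hf.inner_coordVec_zero_zero hθ, hf.inner_coordVec_zero_succ hθ]
  · simp [hf.inner_coordVec_zero_zero hθ, hf.inner_coordVec_zero_succ hθ,
      (Fin.succ_ne_zero j).symm]
  · simp [hf.inner_coordVec_succ_zero hθ, hf.inner_coordVec_succ_succ hθ]
  · have := congrFun (congrFun hmul i) j
    rw [Matrix.mul_apply] at this
    simp [hf.inner_coordVec_succ_zero hθ, hf.inner_coordVec_succ_succ hθ, Matrix.one_apply, this]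

/-- Block diagonality splits the tangential projection into the mean (the `∂_0` part) and the
regression on the scores. -/
lemma secFF_eq (hf : RegularModel μ Θ f) (hθ : θ ∈ Θ) (α : ℝ) (i j : Fin p) (x : X) :
    secFF μ α f i j θ x
      = (logD f [i, j] x θ + (1 - α) / 2 * (logD f [i] x θ * logD f [j] x θ)
          - (moment μ f [[i, j]] θ + (1 - α) / 2 * moment μ f [[i], [j]] θ)
          - ∑ s, ∑ t, (moment μ f [[i, j], [s]] θ
              + (1 - α) / 2 * moment μ f [[i], [j], [s]] θ)
            * (metric μ f θ)⁻¹ s t * logD f [t] x θ) * f x θ := by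
  rw [secFF, secondFundFamily, tangentProj, hf.metric_scaleExt_inv hθ, hf.ambientCov_scaleExt hθ]
  simp only [Fin.sum_univ_succ, scaleExt_basePt, (hf.inner_ambientCov_zero hθ α i j).2,
    (hf.inner_ambientCov_succ hθ α i j _).2, coordVec_scaleExt_zero,
    hf.coordVec_scaleExt_basePt hθ, Matrix.of_apply, Fin.cons_zero, Fin.cons_succ,
    Pi.zero_apply, mul_zero, zero_mul, Finset.sum_const_zero, zero_add, add_zero, gInv, mul_one]
  simp only [← mul_assoc, ← Finset.sum_mul]
  ring

/-- For `α = 1` the coefficient `(1 - α)/2` vanishes, so the first residual is that of `l_ij` alone.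
The product of means is `(-g_ij) * (-(1 - α') g_kl)`, by `moment_hessian`. -/
lemma inner_secFF (hf : RegularModel μ Θ f) (hθ : θ ∈ Θ) (α : ℝ) (i j k l : Fin p) :
    Integrable (innerIntegrand (fun x => f x θ) (secFF μ 1 f i j θ) (secFF μ α f k l θ)) μ ∧
      ambientInner μ (fun x => f x θ) (secFF μ 1 f i j θ) (secFF μ α f k l θ)
        = moment μ f [[i, j], [k, l]] θ + (1 - α) / 2 * moment μ f [[i, j], [k], [l]] θ
          - (1 - (1 - α) / 2) * (metric μ f θ i j * metric μ f θ k l)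
          - ∑ s, ∑ t, moment μ f [[i, j], [s]] θ * gInv μ f θ s t
            * (moment μ f [[k, l], [t]] θ + (1 - α) / 2 * moment μ f [[k], [l], [t]] θ) := by
  refine hf.integrable_and_ambientInner hθ
    (u := fun x => logD f [i, j] x θ - moment μ f [[i, j]] θ
      - ∑ s, ∑ t, moment μ f [[i, j], [s]] θ * (metric μ f θ)⁻¹ s t * logD f [t] x θ)
    ?_ (fun x => ?_) (fun x => hf.secFF_eq hθ α k l x)
  · refine (HasMean.residual_mul (isUnit_iff_ne_zero.2 (hf.det_metric_ne_zero hθ))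
      (hf.hasMean_one hθ) (hf.hasMean_score hθ) (hf.hasMean_score_mul hθ)
      ((hf.hasMean_moment hθ [[i, j]] (by simp) (by simp)).congr (fun x => by simp) rfl)
      (hf.hasMean_cov hθ _ k l) (hf.hasMean_hessian_mul_cov hθ _ i j k l)
      (fun t => (hf.hasMean_moment hθ [[i, j], [t]] (by simp) (by simp)).congr
        (fun x => by simp) rfl)
      (hf.hasMean_cov_mul_score hθ _ k l)).congr (fun x => rfl) ?_
    rw [hf.moment_hessian hθ, hf.moment_hessian hθ, hf.metric_eq hθ, hf.metric_eq hθ]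
    simp only [gInv]
    ring
  · rw [hf.secFF_eq hθ]
    simp

lemma inner_secFFMixed (hf : RegularModel μ Θ f) (hθ : θ ∈ Θ) (α : ℝ) (i j k l : Fin p) :
    ambientInner μ (fun x => f x θ) (secFFMixed μ 1 f i j θ) (secFFMixed μ α f k l θ)
      = ∑ s, ∑ t, gInv μ f θ s j * gInv μ f θ t l *
        ambientInner μ (fun x => f x θ) (secFF μ 1 f i s θ) (secFF μ α f k t θ) := by
  have e : innerIntegrand (fun x => f x θ) (secFFMixed μ 1 f i j θ) (secFFMixed μ α f k l θ)
      = fun x => ∑ s, ∑ t, gInv μ f θ s j * gInv μ f θ t l *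
        innerIntegrand (fun x => f x θ) (secFF μ 1 f i s θ) (secFF μ α f k t θ) x := by
    ext x
    simp only [innerIntegrand, secFFMixed, mul_assoc, Finset.sum_mul, Finset.mul_sum]
    rw [Finset.sum_comm]
    exact Finset.sum_congr rfl fun s _ => Finset.sum_congr rfl fun t _ => by ring
  have hint : ∀ s t, Integrable (fun x => gInv μ f θ s j * gInv μ f θ t l *
      innerIntegrand (fun x => f x θ) (secFF μ 1 f i s θ) (secFF μ α f k t θ) x) μ :=
    fun s t => (hf.inner_secFF hθ α i s k t).1.const_mul _
  rw [ambientInner, e, integral_finsetSum _ fun s _ => integrable_finsetSum _ fun t _ => hint s t]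
  refine Finset.sum_congr rfl fun s _ => ?_
  rw [integral_finsetSum _ fun t _ => hint s t]
  exact Finset.sum_congr rfl fun t _ => integral_const_mul _ _

end RegularModel

end Model

/-! ### Reindexing of multiple sums -/

section Reindex

variable {ι : Type*} [Fintype ι]

lemma sum_piFin_succ {n : ℕ} (F : (Fin (n + 1) → ι) → ℝ) :
    ∑ v, F v = ∑ i, ∑ w : Fin n → ι, F (Matrix.vecCons i w) := by
  rw [← (Fin.consEquiv fun _ => ι).sum_comp, Fintype.sum_prod_type]
  rfl

lemma sum4_eq_sum_pi (F : ι → ι → ι → ι → ℝ) :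
    ∑ i, ∑ j, ∑ k, ∑ l, F i j k l = ∑ v : Fin 4 → ι, F (v 0) (v 1) (v 2) (v 3) := by
  simp only [sum_piFin_succ, Fintype.sum_unique]
  rfl

lemma sum6_eq_sum_pi (F : ι → ι → ι → ι → ι → ι → ℝ) :
    ∑ i, ∑ j, ∑ k, ∑ l, ∑ s, ∑ u, F i j k l s u
      = ∑ v : Fin 6 → ι, F (v 0) (v 1) (v 2) (v 3) (v 4) (v 5) := by
  simp only [sum_piFin_succ, Fintype.sum_unique]
  rfl

lemma sum_pi_comp {n : ℕ} {σ : Fin n → Fin n} (hσ : Function.Injective σ) (F : (Fin n → ι) → ℝ) :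
    ∑ v, F (v ∘ σ) = ∑ v, F v :=
  ((Equiv.ofBijective σ (Finite.injective_iff_bijective.1 hσ)).symm.arrowCongr
    (Equiv.refl ι)).sum_comp F

/-- Seen as a sum over index tuples `Fin 4 → ι`, an iterated sum is invariant under precomposition
with a permutation. Slot `a` of `G` receives variable number `σ a` of `F`. -/
lemma sum4_reindex {F G : ι → ι → ι → ι → ℝ} (σ : Fin 4 → Fin 4) (hσ : Function.Injective σ)
    (h : ∀ i j k l, F i j k l = G (![i, j, k, l] (σ 0)) (![i, j, k, l] (σ 1))
      (![i, j, k, l] (σ 2)) (![i, j, k, l] (σ 3))) :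
    ∑ i, ∑ j, ∑ k, ∑ l, F i j k l = ∑ i, ∑ j, ∑ k, ∑ l, G i j k l := by
  rw [sum4_eq_sum_pi G, ← sum_pi_comp hσ]
  simp only [h, sum_piFin_succ, Fintype.sum_unique]
  rfl

lemma sum6_reindex {F G : ι → ι → ι → ι → ι → ι → ℝ} (σ : Fin 6 → Fin 6)
    (hσ : Function.Injective σ)
    (h : ∀ i j k l s u, F i j k l s u
      = G (![i, j, k, l, s, u] (σ 0)) (![i, j, k, l, s, u] (σ 1)) (![i, j, k, l, s, u] (σ 2))
        (![i, j, k, l, s, u] (σ 3)) (![i, j, k, l, s, u] (σ 4)) (![i, j, k, l, s, u] (σ 5))) :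
    ∑ i, ∑ j, ∑ k, ∑ l, ∑ s, ∑ u, F i j k l s u = ∑ i, ∑ j, ∑ k, ∑ l, ∑ s, ∑ u, G i j k l s u := by
  rw [sum6_eq_sum_pi G, ← sum_pi_comp hσ]
  simp only [h, sum_piFin_succ, Fintype.sum_unique]
  rfl

lemma sum4_congr {F G : ι → ι → ι → ι → ℝ} (h : ∀ i j k l, F i j k l = G i j k l) :
    ∑ i, ∑ j, ∑ k, ∑ l, F i j k l = ∑ i, ∑ j, ∑ k, ∑ l, G i j k l := by
  simp only [h]

lemma sum6_congr {F G : ι → ι → ι → ι → ι → ι → ℝ}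
    (h : ∀ i j k l s u, F i j k l s u = G i j k l s u) :
    ∑ i, ∑ j, ∑ k, ∑ l, ∑ s, ∑ u, F i j k l s u = ∑ i, ∑ j, ∑ k, ∑ l, ∑ s, ∑ u, G i j k l s u := by
  simp only [h]

end Reindex

/-! ### Contractions of symmetric tensors -/

/-- The symmetries of `g^{ij}` and of the moments `L_{(ij)k}`, `L_{ijk}`, `L_{(ij)kl}`, `L_{ijkl}`,
`L_{(ij)(kl)}`. -/
structure MomentSymmetry {p : ℕ} (g : Matrix (Fin p) (Fin p) ℝ) (A B : Fin p → Fin p → Fin p → ℝ)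
    (C D Q : Fin p → Fin p → Fin p → Fin p → ℝ) : Prop where
  g_comm : ∀ i j, g i j = g j i
  A_swap : ∀ i j k, A i j k = A j i k
  B_swap : ∀ i j k, B i j k = B j i k
  B_swap' : ∀ i j k, B i j k = B i k j
  C_swap : ∀ i j k l, C i j k l = C j i k l
  C_swap' : ∀ i j k l, C i j k l = C i j l k
  D_swap : ∀ i j k l, D i j k l = D j i k l
  D_swap' : ∀ i j k l, D i j k l = D i k j l
  D_swap'' : ∀ i j k l, D i j k l = D i j l k
  Q_swap : ∀ i j k l, Q i j k l = Q j i k l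
  Q_swap' : ∀ i j k l, Q i j k l = Q i j l k
  Q_pair : ∀ i j k l, Q i j k l = Q k l i j

namespace MomentSymmetry

variable {p : ℕ} {g : Matrix (Fin p) (Fin p) ℝ} {A B : Fin p → Fin p → Fin p → ℝ}
  {C D Q : Fin p → Fin p → Fin p → Fin p → ℝ} 

/-- The pattern of all the contraction identities below: terms are matched singly, with `![…]`
listing which summation index goes into each slot of the target. Where symmetries are needed, `simp`
uses them as ordered rewriting to bring tensor entries to a common form. Here renaming alone
suffices. -/
lemma F_formula_fourth :
    ∑ i, ∑ j, ∑ k, ∑ s, g i j * g k s * (2 * C i s j k + C k s i j + D i j k s)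
      = 2 * (contract4 g fun i j k l => C i l j k)
        + (contract4 g fun i j k l => C i j k l)
        + (contract4 g fun i j k l => D i j k l) := by
  have h1 : ((∑ i, ∑ j, ∑ k, ∑ s, g i j * g k s * C i s j k) : ℝ)
      = (contract4 g fun i j k l => C i l j k) :=
    sum4_reindex ![0, 1, 2, 3] (by decide) fun i j k s => by
      simp only [Matrix.cons_val]
  have h2 : ((∑ i, ∑ j, ∑ k, ∑ s, g i j * g k s * C k s i j) : ℝ)
      = (contract4 g fun i j k l => C i j k l) :=
    sum4_reindex ![2, 3, 0, 1] (by decide) fun i j k s => by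
      simp only [Matrix.cons_val]
      ring
  have h3 : ((∑ i, ∑ j, ∑ k, ∑ s, g i j * g k s * D i j k s) : ℝ)
      = (contract4 g fun i j k l => D i j k l) :=
    sum4_reindex ![0, 1, 2, 3] (by decide) fun i j k s => by
      simp only [Matrix.cons_val]
  rw [← h1, ← h2, ← h3]
  simp only [Finset.mul_sum, ← Finset.sum_add_distrib]
  exact sum4_congr fun i j k s => by ring

lemma F_formula_third (h : MomentSymmetry g A B C D Q) :
    ∑ i, ∑ j, ∑ k, ∑ l, ∑ s, ∑ u, g k s * g u j * g l i * (B i j k * (2 * A s u l + B s u l))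
      = 2 * (contract6 g fun i j k l s u => A i k s * B j l u)
        + (contract6 g fun i j k l s u => B i k s * B j l u) := by
  have h1 : ((∑ i, ∑ j, ∑ k, ∑ l, ∑ s, ∑ u, g k s * g u j * g l i * (B i j k * A s u l)) : ℝ)
      = (contract6 g fun i j k l s u => A i k s * B j l u) :=
    sum6_reindex ![4, 2, 5, 1, 3, 0] (by decide) fun i j k l s u => by
      simp only [h.B_swap, h.B_swap', h.g_comm, Matrix.cons_val]
      ring
  have h2 : ((∑ i, ∑ j, ∑ k, ∑ l, ∑ s, ∑ u, g k s * g u j * g l i * (B i j k * B s u l)) : ℝ)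
      = (contract6 g fun i j k l s u => B i k s * B j l u) :=
    sum6_reindex ![0, 3, 1, 5, 2, 4] (by decide) fun i j k l s u => by
      simp only [h.B_swap, h.B_swap', h.g_comm, Matrix.cons_val]
      ring
  rw [← h1, ← h2]
  simp only [Finset.mul_sum, ← Finset.sum_add_distrib]
  exact sum6_congr fun i j k l s u => by ring

lemma F_formula_connection (h : MomentSymmetry g A B C D Q) (a : ℝ) :
    ∑ i, ∑ j, ∑ k, ∑ s, ∑ t, ∑ u, g t i * g u j * g k s * ((A i t s + a * B i t s) * B j u k)
      = (contract6 g fun i j k l s u => A i j k * B l s u)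
        + a * (contract6 g fun i j k l s u => B i j k * B l s u) := by
  have h1 : ((∑ i, ∑ j, ∑ k, ∑ s, ∑ t, ∑ u, g t i * g u j * g k s * (A i t s * B j u k)) : ℝ)
      = (contract6 g fun i j k l s u => A i j k * B l s u) :=
    sum6_reindex ![0, 4, 3, 2, 1, 5] (by decide) fun i j k s t u => by
      simp only [h.B_swap, h.B_swap', h.g_comm, Matrix.cons_val]
      ring
  have h2 : ((∑ i, ∑ j, ∑ k, ∑ s, ∑ t, ∑ u, g t i * g u j * g k s * (B i t s * B j u k)) : ℝ)
      = (contract6 g fun i j k l s u => B i j k * B l s u) :=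
    sum6_reindex ![0, 4, 3, 2, 1, 5] (by decide) fun i j k s t u => by
      simp only [h.B_swap, h.B_swap', h.g_comm, Matrix.cons_val]
      ring
  rw [← h1, ← h2]
  simp only [Finset.mul_sum, ← Finset.sum_add_distrib]
  exact sum6_congr fun i j k l s u => by ring

/-- The part of `g^{ks} ∂_s T_{ik}^i` where the derivative falls on `L_{ikl}`. -/
lemma F_deriv_fourth (h : MomentSymmetry g A B C D Q) :
    ∑ k, ∑ s, ∑ i, ∑ l, g k s * g l i * (C s i k l + C s k i l + C s l i k + D i k l s)
      = 2 * (contract4 g fun i j k l => C i l j k)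
        + (contract4 g fun i j k l => C i j k l)
        + (contract4 g fun i j k l => D i j k l) := by
  have h1 : ((∑ k, ∑ s, ∑ i, ∑ l, g k s * g l i * C s i k l) : ℝ)
      = (contract4 g fun i j k l => C i l j k) :=
    sum4_reindex ![1, 0, 3, 2] (by decide) fun k s i l => by
      simp only [h.g_comm, Matrix.cons_val]
  have h2 : ((∑ k, ∑ s, ∑ i, ∑ l, g k s * g l i * C s k i l) : ℝ)
      = (contract4 g fun i j k l => C i j k l) :=
    sum4_reindex ![0, 1, 2, 3] (by decide) fun k s i l => by
      simp only [h.C_swap, h.g_comm, Matrix.cons_val]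
  have h3 : ((∑ k, ∑ s, ∑ i, ∑ l, g k s * g l i * C s l i k) : ℝ)
      = (contract4 g fun i j k l => C i l j k) :=
    sum4_reindex ![1, 0, 2, 3] (by decide) fun k s i l => by
      simp only [h.C_swap', h.g_comm, Matrix.cons_val]
  have h4 : ((∑ k, ∑ s, ∑ i, ∑ l, g k s * g l i * D i k l s) : ℝ)
      = (contract4 g fun i j k l => D i j k l) :=
    sum4_reindex ![0, 1, 2, 3] (by decide) fun k s i l => by
      simp only [h.D_swap, h.D_swap', h.D_swap'', h.g_comm, Matrix.cons_val]
  -- The two copies of the first contraction come from different terms, with `s` joined to `i` in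
  -- one and to `l` in the other, so they are replaced separately.
  rw [two_mul]
  nth_rw 1 [← h1]
  rw [← h2, ← h3, ← h4]
  simp only [← Finset.sum_add_distrib]
  exact sum4_congr fun k s i l => by ring

/-- The complementary part of `g^{ks} ∂_s T_{ik}^i`, up to sign: the derivative falls on the inverse
metric. -/
lemma F_deriv_third (h : MomentSymmetry g A B C D Q) :
    ∑ k, ∑ s, ∑ i, ∑ l, ∑ a, ∑ b, g k s * B i k l * (g l a * g b i * (A s a b + A s b a + B s a b))
      = 2 * (contract6 g fun i j k l s u => A i k s * B j l u)
        + (contract6 g fun i j k l s u => B i k s * B j l u) := by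
  have h1 : ((∑ k, ∑ s, ∑ i, ∑ l, ∑ a, ∑ b, g k s * g l a * g b i * (B i k l * A s a b)) : ℝ)
      = (contract6 g fun i j k l s u => A i k s * B j l u) :=
    sum6_reindex ![1, 0, 4, 3, 5, 2] (by decide) fun k s i l a b => by
      simp only [h.B_swap, h.B_swap', h.g_comm, Matrix.cons_val]
      ring
  have h2 : ((∑ k, ∑ s, ∑ i, ∑ l, ∑ a, ∑ b, g k s * g l a * g b i * (B i k l * A s b a)) : ℝ)
      = (contract6 g fun i j k l s u => A i k s * B j l u) :=
    sum6_reindex ![1, 0, 5, 2, 4, 3] (by decide) fun k s i l a b => by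
      simp only [h.B_swap, h.g_comm, Matrix.cons_val]
      ring
  have h3 : ((∑ k, ∑ s, ∑ i, ∑ l, ∑ a, ∑ b, g k s * g l a * g b i * (B i k l * B s a b)) : ℝ)
      = (contract6 g fun i j k l s u => B i k s * B j l u) :=
    sum6_reindex ![0, 1, 2, 5, 3, 4] (by decide) fun k s i l a b => by
      simp only [h.B_swap, h.B_swap', h.g_comm, Matrix.cons_val]
      ring
  rw [two_mul]
  nth_rw 1 [← h1]
  rw [← h2, ← h3]
  simp only [← Finset.sum_add_distrib]
  exact sum6_congr fun k s i l a b => by ring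

lemma F_connection (h : MomentSymmetry g A B C D Q) (c : ℝ) :
    ∑ i, ∑ j, ∑ s, ∑ t, g t i * (A i t s + c * B i t s) * ∑ l, ∑ m, B j m l * g m j * g l s
      = (contract6 g fun i j k l s u => A i j k * B l s u)
        + c * (contract6 g fun i j k l s u => B i j k * B l s u) := by
  have h1 : ((∑ i, ∑ j, ∑ s, ∑ t, ∑ l, ∑ m, g t i * g m j * g l s * (A i t s * B j m l)) : ℝ)
      = (contract6 g fun i j k l s u => A i j k * B l s u) :=
    sum6_reindex ![0, 3, 2, 4, 1, 5] (by decide) fun i j s t l m => by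
      simp only [h.B_swap, h.B_swap', h.g_comm, Matrix.cons_val]
      ring
  have h2 : ((∑ i, ∑ j, ∑ s, ∑ t, ∑ l, ∑ m, g t i * g m j * g l s * (B i t s * B j m l)) : ℝ)
      = (contract6 g fun i j k l s u => B i j k * B l s u) :=
    sum6_reindex ![0, 3, 2, 4, 1, 5] (by decide) fun i j s t l m => by
      simp only [h.B_swap, h.B_swap', h.g_comm, Matrix.cons_val]
      ring
  rw [← h1, ← h2]
  simp only [Finset.mul_sum, ← Finset.sum_add_distrib]
  exact sum6_congr fun i j k l s u => by ring

lemma cubic_norm_formula :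
    ∑ i, ∑ j, ∑ k, ∑ s, ∑ t, ∑ u, B i j k * B s t u * g i s * g j t * g k u
      = (contract6 g fun i j k l s u => B i k s * B j l u) := by
  have h1 : ((∑ i, ∑ j, ∑ k, ∑ s, ∑ t, ∑ u, g i s * g j t * g k u * (B i j k * B s t u)) : ℝ)
      = (contract6 g fun i j k l s u => B i k s * B j l u) :=
    sum6_reindex ![0, 3, 1, 4, 2, 5] (by decide) fun i j k s t u => by
      simp only [Matrix.cons_val]
  rw [← h1]
  exact sum6_congr fun i j k l s u => by ring

lemma cubic_norm (h : MomentSymmetry g A B C D Q) :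
    ∑ i, ∑ j, ∑ k, B i j k * ∑ t, ∑ m, ∑ l, B t m l * g t i * g m j * g l k
      = (contract6 g fun i j k l s u => B i k s * B j l u) := by
  have h1 : ((∑ i, ∑ j, ∑ k, ∑ t, ∑ m, ∑ l, g t i * g m j * g l k * (B i j k * B t m l)) : ℝ)
      = (contract6 g fun i j k l s u => B i k s * B j l u) :=
    sum6_reindex ![0, 3, 1, 4, 2, 5] (by decide) fun i j k t m l => by
      simp only [h.g_comm, Matrix.cons_val]
  rw [← h1]
  simp only [Finset.mul_sum]
  exact sum6_congr fun i j k l s u => by ring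

lemma cubic_trace_formula (h : MomentSymmetry g A B C D Q) :
    ∑ i, ∑ j, ∑ k, ∑ s, ∑ t, ∑ u, B i j k * B s t u * g i j * g s t * g u k
      = (contract6 g fun i j k l s u => B i j k * B l s u) := by
  have h1 : ((∑ i, ∑ j, ∑ k, ∑ s, ∑ t, ∑ u, g i j * g s t * g u k * (B i j k * B s t u)) : ℝ)
      = (contract6 g fun i j k l s u => B i j k * B l s u) :=
    sum6_reindex ![0, 1, 2, 5, 3, 4] (by decide) fun i j k s t u => by
      simp only [h.B_swap, h.B_swap', h.g_comm, Matrix.cons_val]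
      ring
  rw [← h1]
  exact sum6_congr fun i j k l s u => by ring

lemma cubic_trace (h : MomentSymmetry g A B C D Q) :
    ∑ i, ∑ j, ∑ s, (∑ a, B i s a * g a i) * ∑ l, ∑ m, B j m l * g m j * g l s
      = (contract6 g fun i j k l s u => B i j k * B l s u) := by
  have h1 : ((∑ i, ∑ j, ∑ s, ∑ l, ∑ m, ∑ a, g a i * g m j * g l s * (B i s a * B j m l)) : ℝ)
      = (contract6 g fun i j k l s u => B i j k * B l s u) :=
    sum6_reindex ![0, 5, 2, 3, 1, 4] (by decide) fun i j s l m a => by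
      simp only [h.B_swap, h.B_swap', h.g_comm, Matrix.cons_val]
      ring
  rw [← h1]
  simp only [Finset.sum_mul, Finset.mul_sum]
  exact sum6_congr fun i j k l s u => by ring

lemma curvature_formula_fourth (h : MomentSymmetry g A B C D Q) :
    ∑ i, ∑ j, ∑ k, ∑ s, g i j * g s k * (Q k i j s - Q i j k s + C k i j s - C i j k s)
      = (contract4 g fun i j k l => Q i k j l)
        - (contract4 g fun i j k l => Q i j k l)
        + (contract4 g fun i j k l => C i l j k)
        - (contract4 g fun i j k l => C i j k l) := by
  have h1 : ((∑ i, ∑ j, ∑ k, ∑ s, g i j * g s k * Q k i j s) : ℝ)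
      = (contract4 g fun i j k l => Q i k j l) :=
    sum4_reindex ![0, 1, 2, 3] (by decide) fun i j k s => by
      simp only [h.Q_swap, h.g_comm, Matrix.cons_val]
  have h2 : ((∑ i, ∑ j, ∑ k, ∑ s, g i j * g s k * Q i j k s) : ℝ)
      = (contract4 g fun i j k l => Q i j k l) :=
    sum4_reindex ![0, 1, 2, 3] (by decide) fun i j k s => by
      simp only [h.g_comm, Matrix.cons_val]
  have h3 : ((∑ i, ∑ j, ∑ k, ∑ s, g i j * g s k * C k i j s) : ℝ)
      = (contract4 g fun i j k l => C i l j k) :=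
    sum4_reindex ![0, 1, 3, 2] (by decide) fun i j k s => by
      simp only [h.C_swap, h.g_comm, Matrix.cons_val]
  have h4 : ((∑ i, ∑ j, ∑ k, ∑ s, g i j * g s k * C i j k s) : ℝ)
      = (contract4 g fun i j k l => C i j k l) :=
    sum4_reindex ![0, 1, 2, 3] (by decide) fun i j k s => by
      simp only [h.g_comm, Matrix.cons_val]
  rw [← h1, ← h2, ← h3, ← h4]
  simp only [← Finset.sum_add_distrib, ← Finset.sum_sub_distrib]
  exact sum4_congr fun i j k s => by ring

lemma curvature_formula_third (h : MomentSymmetry g A B C D Q) :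
    ∑ i, ∑ j, ∑ k, ∑ s, ∑ t, ∑ u, g s k * g t i * g u j *
        (-(A k i j * A s t u) + A i t s * A u j k + B s i t * A u j k - B s t u * A i j k)
      = -(contract6 g fun i j k l s u => A i k s * A j l u)
        + (contract6 g fun i j k l s u => A i j k * A s u l)
        + (contract6 g fun i j k l s u => A i j k * B l s u)
        - (contract6 g fun i j k l s u => A i k s * B j l u) := by
  have h1 : ((∑ i, ∑ j, ∑ k, ∑ s, ∑ t, ∑ u, g s k * g t i * g u j * (A k i j * A s t u)) : ℝ)
      = (contract6 g fun i j k l s u => A i k s * A j l u) :=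
    sum6_reindex ![0, 4, 2, 3, 1, 5] (by decide) fun i j k s t u => by
      simp only [h.A_swap, h.g_comm, Matrix.cons_val]
      ring
  have h2 : ((∑ i, ∑ j, ∑ k, ∑ s, ∑ t, ∑ u, g s k * g t i * g u j * (A i t s * A u j k)) : ℝ)
      = (contract6 g fun i j k l s u => A i j k * A s u l) :=
    sum6_reindex ![0, 4, 3, 2, 1, 5] (by decide) fun i j k s t u => by
      simp only [h.A_swap, h.g_comm, Matrix.cons_val]
      ring
  have h3 : ((∑ i, ∑ j, ∑ k, ∑ s, ∑ t, ∑ u, g s k * g t i * g u j * (B s i t * A u j k)) : ℝ)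
      = (contract6 g fun i j k l s u => A i j k * B l s u) :=
    sum6_reindex ![1, 5, 2, 3, 0, 4] (by decide) fun i j k s t u => by
      simp only [h.A_swap, h.B_swap, h.g_comm, Matrix.cons_val]
      ring
  have h4 : ((∑ i, ∑ j, ∑ k, ∑ s, ∑ t, ∑ u, g s k * g t i * g u j * (B s t u * A i j k)) : ℝ)
      = (contract6 g fun i j k l s u => A i k s * B j l u) :=
    sum6_reindex ![0, 4, 1, 5, 2, 3] (by decide) fun i j k s t u => by
      simp only [h.B_swap, h.B_swap', h.g_comm, Matrix.cons_val]
      ring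
  rw [← h1, ← h2, ← h3, ← h4]
  simp only [← Finset.sum_add_distrib, ← Finset.sum_sub_distrib,
    ← Finset.sum_neg_distrib]
  exact sum6_congr fun i j k l s u => by ring

/-- The terms of `∂_i Γ_{js}^j - ∂_j Γ_{is}^j` where the derivative falls on a moment, without those
containing third derivatives of `log f`. -/
lemma curvature_fourth (h : MomentSymmetry g A B C D Q) :
    ∑ i, ∑ j, ∑ s, ∑ t, g s i * g j t * (Q j s i t - Q i s j t + C j s t i - C i s t j)
      = (contract4 g fun i j k l => Q i k j l)
        - (contract4 g fun i j k l => Q i j k l)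
        + (contract4 g fun i j k l => C i l j k)
        - (contract4 g fun i j k l => C i j k l) := by
  have h1 : ((∑ i, ∑ j, ∑ s, ∑ t, g s i * g j t * Q j s i t) : ℝ)
      = (contract4 g fun i j k l => Q i k j l) :=
    sum4_reindex ![0, 2, 3, 1] (by decide) fun i j s t => by
      simp only [h.Q_swap', h.Q_pair, h.g_comm, Matrix.cons_val]
  have h2 : ((∑ i, ∑ j, ∑ s, ∑ t, g s i * g j t * Q i s j t) : ℝ)
      = (contract4 g fun i j k l => Q i j k l) :=
    sum4_reindex ![0, 2, 1, 3] (by decide) fun i j s t => by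
      simp only [h.g_comm, Matrix.cons_val]
  have h3 : ((∑ i, ∑ j, ∑ s, ∑ t, g s i * g j t * C j s t i) : ℝ)
      = (contract4 g fun i j k l => C i l j k) :=
    sum4_reindex ![1, 3, 0, 2] (by decide) fun i j s t => by
      simp only [h.C_swap', h.g_comm, Matrix.cons_val]
      ring
  have h4 : ((∑ i, ∑ j, ∑ s, ∑ t, g s i * g j t * C i s t j) : ℝ)
      = (contract4 g fun i j k l => C i j k l) :=
    sum4_reindex ![0, 2, 1, 3] (by decide) fun i j s t => by
      simp only [h.C_swap', h.g_comm, Matrix.cons_val]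
  rw [← h1, ← h2, ← h3, ← h4]
  simp only [← Finset.sum_add_distrib, ← Finset.sum_sub_distrib]
  exact sum4_congr fun i j k s => by ring

/-- The first sum comes from the derivative of the inverse metric inside the connection
coefficients, the second from the products of two such coefficients. -/
lemma curvature_third (h : MomentSymmetry g A B C D Q) :
    (∑ i, ∑ j, ∑ s, ∑ t, ∑ a, ∑ b, g s i * (g j a * g b t) *
        (A i s t * (A j a b + A j b a + B j a b) - A j s t * (A i a b + A i b a + B i a b)))
      + ∑ i, ∑ j, ∑ s, ∑ r, ∑ t, ∑ u, g s i * g j t * g r u *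
        (A i r t * A j s u - A j r t * A i s u)
      = -(contract6 g fun i j k l s u => A i k s * A j l u)
        + (contract6 g fun i j k l s u => A i j k * A s u l)
        + (contract6 g fun i j k l s u => A i j k * B l s u)
        - (contract6 g fun i j k l s u => A i k s * B j l u) := by
  have h1 : ((∑ i, ∑ j, ∑ s, ∑ t, ∑ a, ∑ b, g s i * g j a * g b t * (A j s t * A i a b)) : ℝ)
      = (contract6 g fun i j k l s u => A i k s * A j l u) :=
    sum6_reindex ![0, 2, 4, 1, 5, 3] (by decide) fun i j s t a b => by
      simp only [h.A_swap, h.g_comm, Matrix.cons_val]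
      ring
  have h2 : ((∑ i, ∑ j, ∑ s, ∑ t, ∑ a, ∑ b, g s i * g j a * g b t * (A j s t * B i a b)) : ℝ)
      = (contract6 g fun i j k l s u => A i k s * B j l u) :=
    sum6_reindex ![1, 4, 2, 0, 3, 5] (by decide) fun i j s t a b => by
      simp only [h.B_swap, h.g_comm, Matrix.cons_val]
      ring
  have h3 : ((∑ i, ∑ j, ∑ s, ∑ t, ∑ a, ∑ b, g s i * g j a * g b t * (A i s t * A j a b)) : ℝ)
      = (contract6 g fun i j k l s u => A i j k * A s u l) :=
    sum6_reindex ![0, 2, 3, 5, 1, 4] (by decide) fun i j s t a b => by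
      simp only [h.g_comm, Matrix.cons_val]
      ring
  have h4 : ((∑ i, ∑ j, ∑ s, ∑ t, ∑ a, ∑ b, g s i * g j a * g b t * (A i s t * B j a b)) : ℝ)
      = (contract6 g fun i j k l s u => A i j k * B l s u) :=
    sum6_reindex ![0, 2, 3, 5, 1, 4] (by decide) fun i j s t a b => by
      simp only [h.B_swap, h.B_swap', h.g_comm, Matrix.cons_val]
      ring
  -- `h5` and `h6` are the cancellations: the `Γ^e` half of `∂ g` offsets the products of connection
  -- coefficients. Only the `Γ^m` half survives, in `h1` to `h4`.
  have h5 : ((∑ i, ∑ j, ∑ s, ∑ t, ∑ a, ∑ b, g s i * g j a * g b t * (A j s t * A i b a)) : ℝ)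
      = (∑ i, ∑ j, ∑ s, ∑ r, ∑ t, ∑ u, g s i * g j t * g r u * (A i r t * A j s u)) :=
    sum6_reindex ![0, 1, 2, 5, 4, 3] (by decide) fun i j s t a b => by
      simp only [h.g_comm, Matrix.cons_val]
      ring
  have h6 : ((∑ i, ∑ j, ∑ s, ∑ t, ∑ a, ∑ b, g s i * g j a * g b t * (A i s t * A j b a)) : ℝ)
      = (∑ i, ∑ j, ∑ s, ∑ r, ∑ t, ∑ u, g s i * g j t * g r u * (A j r t * A i s u)) :=
    sum6_reindex ![0, 1, 2, 5, 4, 3] (by decide) fun i j s t a b => by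
      simp only [h.g_comm, Matrix.cons_val]
      ring
  have h7 : (∑ i, ∑ j, ∑ s, ∑ r, ∑ t, ∑ u, g s i * g j t * g r u *
      (A i r t * A j s u - A j r t * A i s u))
      = (∑ i, ∑ j, ∑ s, ∑ r, ∑ t, ∑ u, g s i * g j t * g r u * (A i r t * A j s u))
        - ∑ i, ∑ j, ∑ s, ∑ r, ∑ t, ∑ u, g s i * g j t * g r u * (A j r t * A i s u) := by
    simp only [mul_sub, Finset.sum_sub_distrib]
  rw [h7, ← h5, ← h6, ← h1, ← h2, ← h3, ← h4]
  simp only [← Finset.sum_add_distrib, ← Finset.sum_sub_distrib, ← Finset.sum_neg_distrib]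
  exact sum6_congr fun i j s t a b => by ring

lemma crossed_formula_hessian_hessian (h : MomentSymmetry g A B C D Q) :
    ∑ i, ∑ j, ∑ k, ∑ l, g j k * g l i * Q i k j l
      = (contract4 g fun i j k l => Q i k j l) := by
  have h1 : ((∑ i, ∑ j, ∑ k, ∑ l, g j k * g l i * Q i k j l) : ℝ)
      = (contract4 g fun i j k l => Q i k j l) :=
    sum4_reindex ![0, 3, 2, 1] (by decide) fun i j k l => by
      simp only [h.Q_swap', h.g_comm, Matrix.cons_val]
      ring
  exact h1

lemma crossed_formula_hessian_score (h : MomentSymmetry g A B C D Q) :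
    ∑ i, ∑ j, ∑ k, ∑ l, g j k * g l i * C i k j l
      = (contract4 g fun i j k l => C i l j k) := by
  have h1 : ((∑ i, ∑ j, ∑ k, ∑ l, g j k * g l i * C i k j l) : ℝ)
      = (contract4 g fun i j k l => C i l j k) :=
    sum4_reindex ![0, 3, 1, 2] (by decide) fun i j k l => by
      simp only [h.C_swap', h.g_comm, Matrix.cons_val]
      ring
  exact h1

lemma crossed_formula_cubic_hessian (h : MomentSymmetry g A B C D Q) :
    ∑ i, ∑ j, ∑ k, ∑ l, ∑ s, ∑ t, g j k * g l i * g s t * (A i k s * A j l t)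
      = (contract6 g fun i j k l s u => A i k s * A j l u) := by
  have h1 : ((∑ i, ∑ j, ∑ k, ∑ l, ∑ s, ∑ t, g j k * g l i * g s t * (A i k s * A j l t)) : ℝ)
      = (contract6 g fun i j k l s u => A i k s * A j l u) :=
    sum6_reindex ![0, 3, 2, 1, 4, 5] (by decide) fun i j k l s t => by
      simp only [h.A_swap, h.g_comm, Matrix.cons_val]
      ring
  exact h1

lemma crossed_formula_cubic_score (h : MomentSymmetry g A B C D Q) :
    ∑ i, ∑ j, ∑ k, ∑ l, ∑ s, ∑ t, g j k * g l i * g s t * (A i k s * B j l t)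
      = (contract6 g fun i j k l s u => A i k s * B j l u) := by
  have h1 : ((∑ i, ∑ j, ∑ k, ∑ l, ∑ s, ∑ t, g j k * g l i * g s t * (A i k s * B j l t)) : ℝ)
      = (contract6 g fun i j k l s u => A i k s * B j l u) :=
    sum6_reindex ![0, 3, 2, 1, 4, 5] (by decide) fun i j k l s t => by
      simp only [h.B_swap, h.g_comm, Matrix.cons_val]
      ring
  exact h1

lemma traced_formula_hessian_hessian :
    ∑ i, ∑ j, ∑ k, ∑ l, g i k * g j l * Q i k j l
      = (contract4 g fun i j k l => Q i j k l) := by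
  have h1 : ((∑ i, ∑ j, ∑ k, ∑ l, g i k * g j l * Q i k j l) : ℝ)
      = (contract4 g fun i j k l => Q i j k l) :=
    sum4_reindex ![0, 2, 1, 3] (by decide) fun i j k l => by
      simp only [Matrix.cons_val]
  exact h1

lemma traced_formula_hessian_score :
    ∑ i, ∑ j, ∑ k, ∑ l, g i k * g j l * C i k j l
      = (contract4 g fun i j k l => C i j k l) := by
  have h1 : ((∑ i, ∑ j, ∑ k, ∑ l, g i k * g j l * C i k j l) : ℝ)
      = (contract4 g fun i j k l => C i j k l) :=
    sum4_reindex ![0, 2, 1, 3] (by decide) fun i j k l => by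
      simp only [Matrix.cons_val]
  exact h1

lemma traced_formula_cubic_hessian :
    ∑ i, ∑ j, ∑ k, ∑ l, ∑ s, ∑ t, g i k * g j l * g s t * (A i k s * A j l t)
      = (contract6 g fun i j k l s u => A i j k * A s u l) := by
  have h1 : ((∑ i, ∑ j, ∑ k, ∑ l, ∑ s, ∑ t, g i k * g j l * g s t * (A i k s * A j l t)) : ℝ)
      = (contract6 g fun i j k l s u => A i j k * A s u l) :=
    sum6_reindex ![0, 2, 4, 5, 1, 3] (by decide) fun i j k l s t => by
      simp only [Matrix.cons_val]
      ring
  exact h1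

lemma traced_formula_cubic_score (h : MomentSymmetry g A B C D Q) :
    ∑ i, ∑ j, ∑ k, ∑ l, ∑ s, ∑ t, g i k * g j l * g s t * (A i k s * B j l t)
      = (contract6 g fun i j k l s u => A i j k * B l s u) := by
  have h1 : ((∑ i, ∑ j, ∑ k, ∑ l, ∑ s, ∑ t, g i k * g j l * g s t * (A i k s * B j l t)) : ℝ)
      = (contract6 g fun i j k l s u => A i j k * B l s u) :=
    sum6_reindex ![0, 2, 4, 5, 1, 3] (by decide) fun i j k l s t => by
      simp only [h.B_swap, h.B_swap', Matrix.cons_val]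
      ring
  exact h1

/-- Serves every `α` at once through `c = α'` and `d = 1 - α'`. The contraction of `G` with itself
stays unevaluated, since its value depends on `G` being inverse to `g`. -/
lemma crossed_inner (h : MomentSymmetry g A B C D Q) (c d : ℝ) (G : Matrix (Fin p) (Fin p) ℝ) :
    ∑ i, ∑ j, ∑ s, ∑ t, g s j * g t i * (Q i s j t + c * C i s j t - d * (G i s * G j t)
        - ∑ a, ∑ b, A i s a * g a b * (A j t b + c * B j t b))
      = (contract4 g fun i j k l => Q i k j l)
        + c * (contract4 g fun i j k l => C i l j k)
        - d * ∑ i, ∑ j, ∑ s, ∑ t, g s j * g t i * (G i s * G j t)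
        - (contract6 g fun i j k l s u => A i k s * A j l u)
        - c * (contract6 g fun i j k l s u => A i k s * B j l u) := by
  have h1 : ((∑ i, ∑ j, ∑ s, ∑ t, g s j * g t i * Q i s j t) : ℝ)
      = (contract4 g fun i j k l => Q i k j l) :=
    sum4_reindex ![0, 3, 2, 1] (by decide) fun i j s t => by
      simp only [h.Q_swap', h.g_comm, Matrix.cons_val]
      ring
  have h2 : ((∑ i, ∑ j, ∑ s, ∑ t, g s j * g t i * C i s j t) : ℝ)
      = (contract4 g fun i j k l => C i l j k) :=
    sum4_reindex ![0, 3, 1, 2] (by decide) fun i j s t => by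
      simp only [h.C_swap', h.g_comm, Matrix.cons_val]
      ring
  have h3 : ((∑ i, ∑ j, ∑ s, ∑ t, ∑ a, ∑ b, g s j * g t i * g a b * (A i s a * A j t b)) : ℝ)
      = (contract6 g fun i j k l s u => A i k s * A j l u) :=
    sum6_reindex ![0, 3, 2, 1, 4, 5] (by decide) fun i j s t a b => by
      simp only [h.A_swap, h.g_comm, Matrix.cons_val]
      ring
  have h4 : ((∑ i, ∑ j, ∑ s, ∑ t, ∑ a, ∑ b, g s j * g t i * g a b * (A i s a * B j t b)) : ℝ)
      = (contract6 g fun i j k l s u => A i k s * B j l u) :=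
    sum6_reindex ![0, 3, 2, 1, 4, 5] (by decide) fun i j s t a b => by
      simp only [h.B_swap, h.g_comm, Matrix.cons_val]
      ring
  rw [← h1, ← h2, ← h3, ← h4]
  simp only [Finset.mul_sum, ← Finset.sum_add_distrib, ← Finset.sum_sub_distrib]
  refine sum4_congr fun i j s t => ?_
  have e : g s j * g t i * ∑ a, ∑ b, A i s a * g a b * (A j t b + c * B j t b)
      = (∑ a, ∑ b, g s j * g t i * g a b * (A i s a * A j t b))
        + ∑ a, ∑ b, c * (g s j * g t i * g a b * (A i s a * B j t b)) := by
    simp only [Finset.mul_sum, ← Finset.sum_add_distrib]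
    exact Finset.sum_congr rfl fun a _ => Finset.sum_congr rfl fun b _ => by ring
  rw [mul_sub, e]
  ring

lemma traced_inner (h : MomentSymmetry g A B C D Q) (c d : ℝ) (G : Matrix (Fin p) (Fin p) ℝ) :
    ∑ i, ∑ j, ∑ s, ∑ t, g s i * g t j * (Q i s j t + c * C i s j t - d * (G i s * G j t)
        - ∑ a, ∑ b, A i s a * g a b * (A j t b + c * B j t b))
      = (contract4 g fun i j k l => Q i j k l)
        + c * (contract4 g fun i j k l => C i j k l)
        - d * ∑ i, ∑ j, ∑ s, ∑ t, g s i * g t j * (G i s * G j t)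
        - (contract6 g fun i j k l s u => A i j k * A s u l)
        - c * (contract6 g fun i j k l s u => A i j k * B l s u) := by
  have h1 : ((∑ i, ∑ j, ∑ s, ∑ t, g s i * g t j * Q i s j t) : ℝ)
      = (contract4 g fun i j k l => Q i j k l) :=
    sum4_reindex ![0, 2, 1, 3] (by decide) fun i j s t => by
      simp only [h.g_comm, Matrix.cons_val]
  have h2 : ((∑ i, ∑ j, ∑ s, ∑ t, g s i * g t j * C i s j t) : ℝ)
      = (contract4 g fun i j k l => C i j k l) :=
    sum4_reindex ![0, 2, 1, 3] (by decide) fun i j s t => by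
      simp only [h.g_comm, Matrix.cons_val]
  have h3 : ((∑ i, ∑ j, ∑ s, ∑ t, ∑ a, ∑ b, g s i * g t j * g a b * (A i s a * A j t b)) : ℝ)
      = (contract6 g fun i j k l s u => A i j k * A s u l) :=
    sum6_reindex ![0, 2, 4, 5, 1, 3] (by decide) fun i j s t a b => by
      simp only [h.g_comm, Matrix.cons_val]
      ring
  have h4 : ((∑ i, ∑ j, ∑ s, ∑ t, ∑ a, ∑ b, g s i * g t j * g a b * (A i s a * B j t b)) : ℝ)
      = (contract6 g fun i j k l s u => A i j k * B l s u) :=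
    sum6_reindex ![0, 2, 4, 5, 1, 3] (by decide) fun i j s t a b => by
      simp only [h.B_swap, h.B_swap', h.g_comm, Matrix.cons_val]
      ring
  rw [← h1, ← h2, ← h3, ← h4]
  simp only [Finset.mul_sum, ← Finset.sum_add_distrib, ← Finset.sum_sub_distrib]
  refine sum4_congr fun i j s t => ?_
  have e : g s i * g t j * ∑ a, ∑ b, A i s a * g a b * (A j t b + c * B j t b)
      = (∑ a, ∑ b, g s i * g t j * g a b * (A i s a * A j t b))
        + ∑ a, ∑ b, c * (g s i * g t j * g a b * (A i s a * B j t b)) := by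
    simp only [Finset.mul_sum, ← Finset.sum_add_distrib]
    exact Finset.sum_congr rfl fun a _ => Finset.sum_congr rfl fun b _ => by ring
  rw [mul_sub, e]
  ring

end MomentSymmetry

/-! ### Contractions along the identity -/

section Trace

variable {p : ℕ} {g G : Matrix (Fin p) (Fin p) ℝ}

lemma sum3_add_add {F F₁ F₂ F₃ : Fin p → Fin p → Fin p → ℝ}
    (h : ∀ i j k, F i j k = F₁ i j k + (F₂ i j k + F₃ i j k)) :
    ∑ i, ∑ j, ∑ k, F i j k = (∑ i, ∑ j, ∑ k, F₁ i j k)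
      + ((∑ i, ∑ j, ∑ k, F₂ i j k) + ∑ i, ∑ j, ∑ k, F₃ i j k) := by
  simp only [h, Finset.sum_add_distrib]

lemma sum_mul_eq_one (h : g * G = 1) (i k : Fin p) :
    ∑ j, g i j * G j k = if i = k then 1 else 0 := by
  rw [← Matrix.mul_apply, h, Matrix.one_apply]

/-- For fixed `i, j` the inner sum factors as `δ_ji δ_ij`, which sums to `p`. In the traced version
below the sum factors as two full traces, hence `p²`. -/
lemma crossed_trace_eq (h : g * G = 1) (hG : ∀ i j, G i j = G j i) (hg : ∀ i j, g i j = g j i) :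
    ∑ i, ∑ j, ∑ s, ∑ t, g s j * g t i * (G i s * G j t) = p := by
  have e : ∀ i j, ∑ s, ∑ t, g s j * g t i * (G i s * G j t) = if i = j then (1 : ℝ) else 0 := by
    intro i j
    have : ∑ s, ∑ t, g s j * g t i * (G i s * G j t)
        = (∑ s, g j s * G s i) * ∑ t, g i t * G t j := by
      rw [Finset.sum_mul_sum]
      refine Finset.sum_congr rfl fun s _ => Finset.sum_congr rfl fun t _ => ?_
      rw [hg j s, hg i t, hG s i, hG t j]
      ring
    rw [this, sum_mul_eq_one h, sum_mul_eq_one h]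
    by_cases hij : i = j <;> simp [hij]
  simp [e]

lemma traced_trace_eq (h : g * G = 1) :
    ∑ i, ∑ j, ∑ s, ∑ t, g s i * g t j * (G i s * G j t) = (p : ℝ) ^ 2 := by
  have e : ∑ i, ∑ s, g s i * G i s = (p : ℝ) := by
    rw [Finset.sum_comm]
    simp [sum_mul_eq_one h]
  have : ∑ i, ∑ j, ∑ s, ∑ t, g s i * g t j * (G i s * G j t)
      = (∑ i, ∑ s, g s i * G i s) * ∑ j, ∑ t, g t j * G j t := by
    simp only [Finset.sum_mul_sum]
    exact sum4_congr fun i j s t => by ring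
  rw [this, e, sq]

end Trace

/-! ### Tensor symmetries of the moments and derivatives of the geometric coefficients. -/

section Model

variable {X : Type*} [MeasurableSpace X] {μ : Measure X} {p : ℕ} {Θ : Set (Fin p → ℝ)}
  {f : X → (Fin p → ℝ) → ℝ} {θ : Fin p → ℝ}

namespace RegularModel

/-- Swaps inside a multi-index are equality of mixed partials of `log f`; swaps between factors are
commutativity of the product. -/
lemma momentSymmetry (hf : RegularModel μ Θ f) (hθ : θ ∈ Θ) :
    MomentSymmetry (gInv μ f θ) (fun i j k => moment μ f [[i, j], [k]] θ)
      (fun i j k => moment μ f [[i], [j], [k]] θ)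
      (fun i j k l => moment μ f [[i, j], [k], [l]] θ)
      (fun i j k l => moment μ f [[i], [j], [k], [l]] θ)
      (fun i j k l => moment μ f [[i, j], [k, l]] θ) where
  g_comm := hf.gInv_comm hθ
  A_swap i j k := hf.moment_swap hθ (by simp) _ i j
  B_swap i j k := moment_perm (List.Perm.swap _ _ _) θ
  B_swap' i j k := moment_perm ((List.Perm.swap _ _ _).cons _) θ
  C_swap i j k l := hf.moment_swap hθ (by simp) _ i j
  C_swap' i j k l := moment_perm ((List.Perm.swap _ _ _).cons _) θ
  D_swap i j k l := moment_perm (List.Perm.swap _ _ _) θ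
  D_swap' i j k l := moment_perm ((List.Perm.swap _ _ _).cons _) θ
  D_swap'' i j k l := moment_perm (((List.Perm.swap _ _ _).cons _).cons _) θ
  Q_swap i j k l := hf.moment_swap hθ (by simp) _ i j
  Q_swap' i j k l := by
    rw [moment_perm (List.Perm.swap [k, l] [i, j] []), hf.moment_swap hθ (by simp) _ k l,
      moment_perm (List.Perm.swap [i, j] [l, k] [])]
  Q_pair i j k l := moment_perm (List.Perm.swap _ _ _) θ

/-! ### Derivatives of `T_{ik}^i` and of the connection coefficients -/

/-- The expression of `T_{ik}^i` through moments holds on all of the open set `Θ`, so it can be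
differentiated by the product rule. -/
lemma hasLineDerivAt_traceT (hf : RegularModel μ Θ f) (hθ : θ ∈ Θ) (k s : Fin p) :
    HasLineDerivAt ℝ (traceT μ f k)
      (∑ i, ∑ l, ((moment μ f [[s, i], [k], [l]] θ + moment μ f [[s, k], [i], [l]] θ
          + moment μ f [[s, l], [i], [k]] θ + moment μ f [[i], [k], [l], [s]] θ) * gInv μ f θ l i
        + moment μ f [[i], [k], [l]] θ * -∑ a, ∑ b, gInv μ f θ l a * gInv μ f θ b i *
          (moment μ f [[s, a], [b]] θ + moment μ f [[s, b], [a]] θ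
            + moment μ f [[s], [a], [b]] θ)))
      θ (Pi.single s 1) := by
  have h : HasLineDerivAt ℝ
      (fun η => ∑ i, ∑ l, moment μ f [[i], [k], [l]] η * gInv μ f η l i) _ θ (Pi.single s 1) :=
    hasLineDerivAt_sum fun i _ => hasLineDerivAt_sum fun l _ =>
      hasLineDerivAt_mul (hf.hasLineDerivAt_moment_three hθ (A := [i]) (B := [k]) (C := [l])
        (by simp) (by simp) (by simp) (by simp) s) (hf.hasLineDerivAt_gInv hθ s l i)
  have e1 : ∀ i l, moment μ f [[i], [s, k], [l]] θ = moment μ f [[s, k], [i], [l]] θ :=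
    fun i l => moment_perm (List.Perm.swap _ _ _) θ
  have e2 : ∀ i l, moment μ f [[i], [k], [s, l]] θ = moment μ f [[s, l], [i], [k]] θ :=
    fun i l => moment_perm (List.perm_append_comm (l₁ := [[i], [k]]) (l₂ := [[s, l]])) θ
  simp only [e1, e2] at h
  refine h.congr_of_eventuallyEq ?_
  filter_upwards [hf.isOpen.mem_nhds hθ] with η hη
  simp only [traceT, T21, hf.T3_eq hη]

lemma GamUp_eq (hf : RegularModel μ Θ f) (hθ : θ ∈ Θ) (i j k : Fin p) :
    GamUp μ 1 f i j k θ = ∑ t, moment μ f [[i, j], [t]] θ * gInv μ f θ k t := by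
  simp [GamUp, hf.Gam_eq hθ]

lemma hasLineDerivAt_GamUp (hf : RegularModel μ Θ f) (hθ : θ ∈ Θ) (i j k s : Fin p) :
    HasLineDerivAt ℝ (GamUp μ 1 f i j k)
      (∑ t, ((moment μ f [[s, i, j], [t]] θ + moment μ f [[i, j], [s, t]] θ
          + moment μ f [[i, j], [t], [s]] θ) * gInv μ f θ k t
        + moment μ f [[i, j], [t]] θ * -∑ a, ∑ b, gInv μ f θ k a * gInv μ f θ b t *
          (moment μ f [[s, a], [b]] θ + moment μ f [[s, b], [a]] θ
            + moment μ f [[s], [a], [b]] θ)))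
      θ (Pi.single s 1) := by
  have h : HasLineDerivAt ℝ
      (fun η => ∑ t, moment μ f [[i, j], [t]] η * gInv μ f η k t) _ θ (Pi.single s 1) :=
    hasLineDerivAt_sum fun t _ =>
      hasLineDerivAt_mul (hf.hasLineDerivAt_moment_two hθ (A := [i, j]) (B := [t])
        (by simp) (by simp) (by simp) s) (hf.hasLineDerivAt_gInv hθ s k t)
  refine h.congr_of_eventuallyEq ?_
  filter_upwards [hf.isOpen.mem_nhds hθ] with η hη using hf.GamUp_eq hη i j k

end RegularModel

/-- Coordinate fields have constant components: their bracket vanishes and `∇_{∂_j} ∂_k` has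
components `Γ_{jk}^r`. -/
lemma curvature_coord (Γ : Fin p → Fin p → Fin p → (Fin p → ℝ) → ℝ) (i j k l : Fin p) :
    curvature Γ (fun _ => Pi.single i 1) (fun _ => Pi.single j 1) (fun _ => Pi.single k 1) θ l
      = partialD i (Γ j k l) θ + (∑ r, Γ i r l θ * Γ j k r θ)
        - partialD j (Γ i k l) θ - ∑ r, Γ j r l θ * Γ i k r θ := by
  have hc : ∀ (c : ℝ) (i : Fin p) (η : Fin p → ℝ), partialD i (fun _ => c) η = 0 := by
    intro c i η
    simp [partialD, lineDeriv]
  have h1 : ∀ j : Fin p, covDeriv Γ (fun _ => Pi.single j 1) (fun _ => Pi.single k 1)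
      = fun η r => Γ j k r η := by
    intro j
    ext η r
    simp [covDeriv, hc, Pi.single_apply]
  have h2 : bracket (fun _ : Fin p → ℝ => (Pi.single i 1 : Fin p → ℝ))
      (fun _ => Pi.single j 1) = 0 := by
    ext η r
    simp [bracket, hc]
  rw [curvature, h1, h1, h2]
  simp [covDeriv, Pi.single_apply]
  ring

/-! ### The scalar invariants as contracted moments. -/

namespace RegularModel

lemma FAlpha_eq (hf : RegularModel μ Θ f) (hθ : θ ∈ Θ) (α : ℝ) :
    FAlpha μ α f θ = 2 * L11 μ f θ + L12 μ f θ + L13 μ f θ - 2 * L21 μ f θ - L23 μ f θ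
      - L22 μ f θ - (1 - α) / 2 * L24 μ f θ := by
  have hs := hf.momentSymmetry hθ
  have hd : ∀ k s, partialD s (traceT μ f k) θ = _ := fun k s =>
    (hf.hasLineDerivAt_traceT hθ k s).lineDeriv
  have e4 := hs.F_deriv_fourth
  have e3 := hs.F_deriv_third
  have ec := hs.F_connection ((1 - α) / 2)
  rw [FAlpha]
  simp only [hd, hf.Gam_eq hθ, T12, hf.T3_eq hθ]
  have e : (∑ k, ∑ s, gInv μ f θ k s *
      ∑ i, ∑ l, ((moment μ f [[s, i], [k], [l]] θ + moment μ f [[s, k], [i], [l]] θ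
          + moment μ f [[s, l], [i], [k]] θ + moment μ f [[i], [k], [l], [s]] θ) * gInv μ f θ l i
        + moment μ f [[i], [k], [l]] θ * -∑ a, ∑ b, gInv μ f θ l a * gInv μ f θ b i *
          (moment μ f [[s, a], [b]] θ + moment μ f [[s, b], [a]] θ
            + moment μ f [[s], [a], [b]] θ)))
      = (∑ k, ∑ s, ∑ i, ∑ l, gInv μ f θ k s * gInv μ f θ l i *
          (moment μ f [[s, i], [k], [l]] θ + moment μ f [[s, k], [i], [l]] θ
          + moment μ f [[s, l], [i], [k]] θ + moment μ f [[i], [k], [l], [s]] θ))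
        - ∑ k, ∑ s, ∑ i, ∑ l, ∑ a, ∑ b, gInv μ f θ k s * moment μ f [[i], [k], [l]] θ *
          (gInv μ f θ l a * gInv μ f θ b i * (moment μ f [[s, a], [b]] θ
            + moment μ f [[s, b], [a]] θ + moment μ f [[s], [a], [b]] θ)) := by
    simp only [← Finset.sum_sub_distrib]
    refine Finset.sum_congr rfl fun k _ => Finset.sum_congr rfl fun s _ => ?_
    rw [Finset.mul_sum]
    refine Finset.sum_congr rfl fun i _ => ?_
    rw [Finset.mul_sum]
    refine Finset.sum_congr rfl fun l _ => ?_
    simp only [← Finset.mul_sum]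
    ring
  rw [e]
  unfold L11 L12 L13 L21 L22 L23 L24
  linear_combination e4 - e3 - ec

lemma cubic_norm_eq (hf : RegularModel μ Θ f) (hθ : θ ∈ Θ) :
    ∑ i, ∑ j, ∑ k, T3 μ f i j k θ * T03 μ f i j k θ = L23 μ f θ := by
  simp only [T03, hf.T3_eq hθ]
  exact (hf.momentSymmetry hθ).cubic_norm

lemma cubic_trace_eq (hf : RegularModel μ Θ f) (hθ : θ ∈ Θ) :
    ∑ i, ∑ j, ∑ s, T21 μ f i s i θ * T12 μ f j j s θ = L24 μ f θ := by
  simp only [T21, T12, hf.T3_eq hθ]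
  exact (hf.momentSymmetry hθ).cubic_trace

lemma curvature_eq (hf : RegularModel μ Θ f) (hθ : θ ∈ Θ) :
    ∑ i, ∑ j, Re22 μ f i j i j θ = L14 μ f θ - L15 μ f θ + L11 μ f θ - L12 μ f θ
      - L25 μ f θ + L26 μ f θ + L22 μ f θ - L21 μ f θ := by
  have hs := hf.momentSymmetry hθ
  have hd : ∀ i j k s, partialD s (GamUp μ 1 f i j k) θ = _ := fun i j k s =>
    (hf.hasLineDerivAt_GamUp hθ i j k s).lineDeriv
  have e4 := hs.curvature_fourth
  have e3 := hs.curvature_third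
  simp only [Re22, Re31, curvature_coord, hd, hf.GamUp_eq hθ]
  -- The curvature is split into three groups: derivatives of moments, derivatives of the inverse
  -- metric, and products of connection coefficients.
  refine Eq.trans (b := (∑ i, ∑ j, ∑ s, ∑ t, gInv μ f θ s i * gInv μ f θ j t *
      (moment μ f [[j, s], [i, t]] θ - moment μ f [[i, s], [j, t]] θ
        + moment μ f [[j, s], [t], [i]] θ - moment μ f [[i, s], [t], [j]] θ))
    + ((∑ i, ∑ j, ∑ s, ∑ t, ∑ a, ∑ b, gInv μ f θ s i * (gInv μ f θ j a * gInv μ f θ b t) *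
        (moment μ f [[i, s], [t]] θ * (moment μ f [[j, a], [b]] θ + moment μ f [[j, b], [a]] θ
            + moment μ f [[j], [a], [b]] θ)
          - moment μ f [[j, s], [t]] θ * (moment μ f [[i, a], [b]] θ
            + moment μ f [[i, b], [a]] θ + moment μ f [[i], [a], [b]] θ)))
      + ∑ i, ∑ j, ∑ s, ∑ r, ∑ t, ∑ u, gInv μ f θ s i * gInv μ f θ j t * gInv μ f θ r u *
        (moment μ f [[i, r], [t]] θ * moment μ f [[j, s], [u]] θ
          - moment μ f [[j, r], [t]] θ * moment μ f [[i, s], [u]] θ))) ?_ ?_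
  · refine sum3_add_add fun i j s => ?_
    -- Third derivatives of `log f` enter both derivative terms of the curvature; symmetry in `i, j`
    -- makes them cancel.
    have hP : ∀ t, moment μ f [[j, i, s], [t]] θ = moment μ f [[i, j, s], [t]] θ := fun t =>
      hf.moment_swap hθ (by simp) _ j i
    have hR : (∑ r, ∑ t, ∑ u, gInv μ f θ s i * gInv μ f θ j t * gInv μ f θ r u *
        (moment μ f [[i, r], [t]] θ * moment μ f [[j, s], [u]] θ
          - moment μ f [[j, r], [t]] θ * moment μ f [[i, s], [u]] θ))
        = gInv μ f θ s i * ((∑ r, (∑ t, moment μ f [[i, r], [t]] θ * gInv μ f θ j t) *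
            ∑ u, moment μ f [[j, s], [u]] θ * gInv μ f θ r u)
          - ∑ r, (∑ t, moment μ f [[j, r], [t]] θ * gInv μ f θ j t) *
            ∑ u, moment μ f [[i, s], [u]] θ * gInv μ f θ r u) := by
      simp only [Finset.sum_mul_sum]
      simp only [← Finset.sum_sub_distrib, Finset.mul_sum]
      exact Finset.sum_congr rfl fun r _ => Finset.sum_congr rfl fun t _ =>
        Finset.sum_congr rfl fun u _ => by ring
    rw [hR]
    have hD : (∑ t, gInv μ f θ s i * gInv μ f θ j t *
          (moment μ f [[j, s], [i, t]] θ - moment μ f [[i, s], [j, t]] θ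
            + moment μ f [[j, s], [t], [i]] θ - moment μ f [[i, s], [t], [j]] θ))
        + (∑ t, ∑ a, ∑ b, gInv μ f θ s i * (gInv μ f θ j a * gInv μ f θ b t) *
          (moment μ f [[i, s], [t]] θ * (moment μ f [[j, a], [b]] θ + moment μ f [[j, b], [a]] θ
              + moment μ f [[j], [a], [b]] θ)
            - moment μ f [[j, s], [t]] θ * (moment μ f [[i, a], [b]] θ
              + moment μ f [[i, b], [a]] θ + moment μ f [[i], [a], [b]] θ)))
        = gInv μ f θ s i * (
          (∑ t, ((moment μ f [[i, j, s], [t]] θ + moment μ f [[j, s], [i, t]] θ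
              + moment μ f [[j, s], [t], [i]] θ) * gInv μ f θ j t
            + moment μ f [[j, s], [t]] θ * -∑ a, ∑ b, gInv μ f θ j a * gInv μ f θ b t *
              (moment μ f [[i, a], [b]] θ + moment μ f [[i, b], [a]] θ
                + moment μ f [[i], [a], [b]] θ)))
          - ∑ t, ((moment μ f [[j, i, s], [t]] θ + moment μ f [[i, s], [j, t]] θ
              + moment μ f [[i, s], [t], [j]] θ) * gInv μ f θ j t
            + moment μ f [[i, s], [t]] θ * -∑ a, ∑ b, gInv μ f θ j a * gInv μ f θ b t *
              (moment μ f [[j, a], [b]] θ + moment μ f [[j, b], [a]] θ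
                + moment μ f [[j], [a], [b]] θ))) := by
      rw [← Finset.sum_sub_distrib, ← Finset.sum_add_distrib, Finset.mul_sum]
      refine Finset.sum_congr rfl fun t _ => ?_
      have hT : (∑ a, ∑ b, gInv μ f θ s i * (gInv μ f θ j a * gInv μ f θ b t) *
          (moment μ f [[i, s], [t]] θ * (moment μ f [[j, a], [b]] θ + moment μ f [[j, b], [a]] θ
              + moment μ f [[j], [a], [b]] θ)
            - moment μ f [[j, s], [t]] θ * (moment μ f [[i, a], [b]] θ
              + moment μ f [[i, b], [a]] θ + moment μ f [[i], [a], [b]] θ)))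
          = gInv μ f θ s i * (moment μ f [[i, s], [t]] θ *
              (∑ a, ∑ b, gInv μ f θ j a * gInv μ f θ b t *
                (moment μ f [[j, a], [b]] θ + moment μ f [[j, b], [a]] θ
                  + moment μ f [[j], [a], [b]] θ))
            - moment μ f [[j, s], [t]] θ * ∑ a, ∑ b, gInv μ f θ j a * gInv μ f θ b t *
              (moment μ f [[i, a], [b]] θ + moment μ f [[i, b], [a]] θ
                + moment μ f [[i], [a], [b]] θ)) := by
        simp only [Finset.mul_sum, ← Finset.sum_sub_distrib]
        exact Finset.sum_congr rfl fun a _ => Finset.sum_congr rfl fun b _ => by ring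
      rw [hT, hP]
      ring
    linear_combination -hD
  · unfold L14 L15 L11 L12 L25 L26 L22 L21
    linear_combination e4 + e3

lemma gInv_mul_metric (hf : RegularModel μ Θ f) (hθ : θ ∈ Θ) :
    gInv μ f θ * metric μ f θ = 1 :=
  Matrix.nonsing_inv_mul _ (isUnit_iff_ne_zero.2 (hf.det_metric_ne_zero hθ))

/-- Keeping `α` free covers `e` with `e` (`α' = 0`) and `e` with `m` (`α' = 1`, where the `p` term
drops out). -/
lemma crossed_secFF_eq (hf : RegularModel μ Θ f) (hθ : θ ∈ Θ) (α : ℝ) :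
    ∑ i, ∑ j, ambientInner μ (fun x => f x θ) (secFFMixed μ 1 f i j θ) (secFFMixed μ α f j i θ)
      = L14 μ f θ + (1 - α) / 2 * L11 μ f θ - (1 - (1 - α) / 2) * p - L25 μ f θ
        - (1 - α) / 2 * L21 μ f θ := by
  simp only [hf.inner_secFFMixed hθ, (hf.inner_secFF hθ _ _ _ _ _).2]
  refine ((hf.momentSymmetry hθ).crossed_inner _ _ (metric μ f θ)).trans ?_
  rw [crossed_trace_eq (hf.gInv_mul_metric hθ) (hf.metric_comm hθ) (hf.gInv_comm hθ)]
  rfl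

lemma traced_secFF_eq (hf : RegularModel μ Θ f) (hθ : θ ∈ Θ) (α : ℝ) :
    ∑ i, ∑ j, ambientInner μ (fun x => f x θ) (secFFMixed μ 1 f i i θ) (secFFMixed μ α f j j θ)
      = L15 μ f θ + (1 - α) / 2 * L12 μ f θ - (1 - (1 - α) / 2) * (p : ℝ) ^ 2 - L26 μ f θ
        - (1 - α) / 2 * L22 μ f θ := by
  simp only [hf.inner_secFFMixed hθ, (hf.inner_secFF hθ _ _ _ _ _).2]
  refine ((hf.momentSymmetry hθ).traced_inner _ _ (metric μ f θ)).trans ?_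
  rw [traced_trace_eq (hf.gInv_mul_metric hθ)]
  rfl

end RegularModel

end Model

end InfoGeom

/-! ### The claim, assembled from the invariants and the contraction identities. -/

theorem mainTheorem7 {X : Type*} [MeasurableSpace X] (μ : Measure X) {p : ℕ}
    (Θ : Set (Fin p → ℝ)) (f : X → (Fin p → ℝ) → ℝ) (hf : RegularModel μ Θ f)
    (θ : Fin p → ℝ) (hθ : θ ∈ Θ) :
    let g := gInv μ f θ
    let L := fun Is : List (List (Fin p)) => moment μ f Is θ
    -- the integrals and derivatives that define the geometric quantities exist
    ((∀ i j : Fin (p + 1), Integrable (innerIntegrand (fun x => f x θ)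
          (coordVec (scaleExt f) i (basePt θ)) (coordVec (scaleExt f) j (basePt θ))) μ) ∧
      (∀ (α : ℝ) (i j : Fin p) (k : Fin (p + 1)), Integrable (innerIntegrand (fun x => f x θ)
          (ambientCov α (scaleExt f) i.succ (coordVec (scaleExt f) j.succ) (basePt θ))
          (coordVec (scaleExt f) k (basePt θ))) μ) ∧
      (∀ k s : Fin p, LineDifferentiableAt ℝ (traceT μ f k) θ (Pi.single s 1)) ∧
      (∀ i j k s : Fin p, LineDifferentiableAt ℝ (GamUp μ 1 f i j k) θ (Pi.single s 1)) ∧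
      (∀ i j k l : Fin p, Integrable (innerIntegrand (fun x => f x θ)
          (secFF μ 1 f i j θ) (secFF μ 1 f k l θ)) μ) ∧
      (∀ i j k l : Fin p, Integrable (innerIntegrand (fun x => f x θ)
          (secFF μ 1 f i j θ) (secFF μ (-1) f k l θ)) μ)) ∧
    -- the Fisher metric
    (∀ i j, metric μ f θ i j = L [[i], [j]] ∧ metric μ f θ i j = -L [[i, j]]) ∧
    -- `F^α`
    (∀ α : ℝ,
      FAlpha μ α f θ =
          (∑ i, ∑ j, ∑ k, ∑ s, g i j * g k s *
            (2 * L [[i, s], [j], [k]] + L [[k, s], [i], [j]] + L [[i], [j], [k], [s]]))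
          - (∑ i, ∑ j, ∑ k, ∑ l, ∑ s, ∑ u, g k s * g u j * g l i *
            (L [[i], [j], [k]] * (2 * L [[s, u], [l]] + L [[s], [u], [l]])))
          - (∑ i, ∑ j, ∑ k, ∑ s, ∑ t, ∑ u, g t i * g u j * g k s *
            ((L [[i, t], [s]] + (1 - α) / 2 * L [[i], [t], [s]]) * L [[j], [u], [k]])) ∧
      FAlpha μ α f θ = 2 * L11 μ f θ + L12 μ f θ + L13 μ f θ - 2 * L21 μ f θ - L23 μ f θ
          - L22 μ f θ - (1 - α) / 2 * L24 μ f θ) ∧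
    -- `T_{ijk} T^{ijk}`
    ((∑ i, ∑ j, ∑ k, T3 μ f i j k θ * T03 μ f i j k θ) =
          ∑ i, ∑ j, ∑ k, ∑ s, ∑ t, ∑ u,
            L [[i], [j], [k]] * L [[s], [t], [u]] * g i s * g j t * g k u ∧
      (∑ i, ∑ j, ∑ k, T3 μ f i j k θ * T03 μ f i j k θ) = L23 μ f θ) ∧
    -- `T_{is}^i T_j^{js}`
    ((∑ i, ∑ j, ∑ s, T21 μ f i s i θ * T12 μ f j j s θ) =
          ∑ i, ∑ j, ∑ k, ∑ s, ∑ t, ∑ u,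
            L [[i], [j], [k]] * L [[s], [t], [u]] * g i j * g s t * g u k ∧
      (∑ i, ∑ j, ∑ s, T21 μ f i s i θ * T12 μ f j j s θ) = L24 μ f θ) ∧
    -- the `e`-scalar curvature `R_{ij}^{ij}`
    ((∑ i, ∑ j, Re22 μ f i j i j θ) =
          (∑ i, ∑ j, ∑ k, ∑ s, g i j * g s k *
            (L [[k, i], [j, s]] - L [[i, j], [k, s]] + L [[k, i], [j], [s]]
              - L [[i, j], [k], [s]]))
          + (∑ i, ∑ j, ∑ k, ∑ s, ∑ t, ∑ u, g s k * g t i * g u j *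
            (-(L [[k, i], [j]] * L [[s, t], [u]]) + L [[i, t], [s]] * L [[u, j], [k]]
              + L [[s], [i], [t]] * L [[u, j], [k]] - L [[s], [t], [u]] * L [[i, j], [k]])) ∧
      (∑ i, ∑ j, Re22 μ f i j i j θ) = L14 μ f θ - L15 μ f θ + L11 μ f θ - L12 μ f θ
          - L25 μ f θ + L26 μ f θ + L22 μ f θ - L21 μ f θ) ∧
    -- the inner products of the second fundamental forms: `e` with `e`, indices crossed
    ((∑ i, ∑ j, ambientInner μ (fun x => f x θ) (secFFMixed μ 1 f i j θ)
            (secFFMixed μ 1 f j i θ)) =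
          (∑ i, ∑ j, ∑ k, ∑ l, g j k * g l i * L [[i, k], [j, l]])
          - (∑ i, ∑ j, ∑ k, ∑ l, ∑ s, ∑ t, g j k * g l i * g s t *
              (L [[i, k], [s]] * L [[j, l], [t]])) - (p : ℝ) ∧
      (∑ i, ∑ j, ambientInner μ (fun x => f x θ) (secFFMixed μ 1 f i j θ)
            (secFFMixed μ 1 f j i θ)) = L14 μ f θ - L25 μ f θ - (p : ℝ)) ∧
    -- `e` with `e`, traces
    ((∑ i, ∑ j, ambientInner μ (fun x => f x θ) (secFFMixed μ 1 f i i θ)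
            (secFFMixed μ 1 f j j θ)) =
          (∑ i, ∑ j, ∑ k, ∑ l, g i k * g j l * L [[i, k], [j, l]])
          - (∑ i, ∑ j, ∑ k, ∑ l, ∑ s, ∑ t, g i k * g j l * g s t *
              (L [[i, k], [s]] * L [[j, l], [t]])) - (p : ℝ) ^ 2 ∧
      (∑ i, ∑ j, ambientInner μ (fun x => f x θ) (secFFMixed μ 1 f i i θ)
            (secFFMixed μ 1 f j j θ)) = L15 μ f θ - L26 μ f θ - (p : ℝ) ^ 2) ∧
    -- `e` with `m`, indices crossed
    ((∑ i, ∑ j, ambientInner μ (fun x => f x θ) (secFFMixed μ 1 f i j θ)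
            (secFFMixed μ (-1) f j i θ)) =
          (∑ i, ∑ j, ∑ k, ∑ l, g j k * g l i * L [[i, k], [j], [l]])
          + (∑ i, ∑ j, ∑ k, ∑ l, g j k * g l i * L [[i, k], [j, l]])
          - (∑ i, ∑ j, ∑ k, ∑ l, ∑ s, ∑ t, g j k * g l i * g s t *
              (L [[i, k], [s]] * L [[j, l], [t]]))
          - (∑ i, ∑ j, ∑ k, ∑ l, ∑ s, ∑ t, g j k * g l i * g s t *
              (L [[i, k], [s]] * L [[j], [l], [t]])) ∧
      (∑ i, ∑ j, ambientInner μ (fun x => f x θ) (secFFMixed μ 1 f i j θ)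
            (secFFMixed μ (-1) f j i θ)) =
          L11 μ f θ + L14 μ f θ - L25 μ f θ - L21 μ f θ) ∧
    -- `e` with `m`, traces
    ((∑ i, ∑ j, ambientInner μ (fun x => f x θ) (secFFMixed μ 1 f i i θ)
            (secFFMixed μ (-1) f j j θ)) =
          (∑ i, ∑ j, ∑ k, ∑ l, g i k * g j l * L [[i, k], [j], [l]])
          + (∑ i, ∑ j, ∑ k, ∑ l, g i k * g j l * L [[i, k], [j, l]])
          - (∑ i, ∑ j, ∑ k, ∑ l, ∑ s, ∑ t, g i k * g j l * g s t *
              (L [[i, k], [s]] * L [[j, l], [t]]))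
          - (∑ i, ∑ j, ∑ k, ∑ l, ∑ s, ∑ t, g i k * g j l * g s t *
              (L [[i, k], [s]] * L [[j], [l], [t]])) ∧
      (∑ i, ∑ j, ambientInner μ (fun x => f x θ) (secFFMixed μ 1 f i i θ)
            (secFFMixed μ (-1) f j j θ)) =
          L12 μ f θ + L15 μ f θ - L26 μ f θ - L22 μ f θ) := by
  intro g L
  have hs := hf.momentSymmetry hθ
  have hcross := hf.crossed_secFF_eq hθ
  have htrace := hf.traced_secFF_eq hθ
  refine ⟨⟨hf.integrable_inner_coordVec hθ, hf.integrable_inner_ambientCov hθ,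
    fun k s => (hf.hasLineDerivAt_traceT hθ k s).lineDifferentiableAt,
    fun i j k s => (hf.hasLineDerivAt_GamUp hθ i j k s).lineDifferentiableAt,
    fun i j k l => (hf.inner_secFF hθ 1 i j k l).1,
    fun i j k l => (hf.inner_secFF hθ (-1) i j k l).1⟩,
    fun i j => ⟨hf.metric_eq hθ i j, by
      rw [hf.metric_eq hθ]
      exact (neg_eq_iff_eq_neg.2 (hf.moment_hessian hθ i j)).symm⟩,
    fun α => ⟨?_, hf.FAlpha_eq hθ α⟩,
    ⟨(hf.cubic_norm_eq hθ).trans MomentSymmetry.cubic_norm_formula.symm, hf.cubic_norm_eq hθ⟩,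
    ⟨(hf.cubic_trace_eq hθ).trans hs.cubic_trace_formula.symm, hf.cubic_trace_eq hθ⟩,
    ⟨?_, hf.curvature_eq hθ⟩, ⟨?_, ?_⟩, ⟨?_, ?_⟩, ⟨?_, ?_⟩, ⟨?_, ?_⟩⟩
  -- The long formula follows from the short one: each displayed sum is rewritten as a combination
  -- of standard contractions, with `_` filled in by unification. The curvature and second
  -- fundamental form formulas below are treated alike.
  · refine (hf.FAlpha_eq hθ α).trans ?_
    have e1 : _ = 2 * L11 μ f θ + L12 μ f θ + L13 μ f θ := MomentSymmetry.F_formula_fourth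
    have e2 : _ = 2 * L21 μ f θ + L23 μ f θ := hs.F_formula_third
    have e3 : _ = L22 μ f θ + (1 - α) / 2 * L24 μ f θ := hs.F_formula_connection ((1 - α) / 2)
    linear_combination -e1 + e2 + e3
  · refine (hf.curvature_eq hθ).trans ?_
    have e1 : _ = L14 μ f θ - L15 μ f θ + L11 μ f θ - L12 μ f θ := hs.curvature_formula_fourth
    have e2 : _ = -L25 μ f θ + L26 μ f θ + L22 μ f θ - L21 μ f θ := hs.curvature_formula_third
    linear_combination -e1 - e2
  · refine (hcross 1).trans ?_
    have e1 : _ = L14 μ f θ := hs.crossed_formula_hessian_hessian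
    have e2 : _ = L25 μ f θ := hs.crossed_formula_cubic_hessian
    linear_combination -e1 + e2
  · rw [hcross]
    ring
  · refine (htrace 1).trans ?_
    have e1 : _ = L15 μ f θ := MomentSymmetry.traced_formula_hessian_hessian
    have e2 : _ = L26 μ f θ := MomentSymmetry.traced_formula_cubic_hessian
    linear_combination -e1 + e2
  · rw [htrace]
    ring
  · refine (hcross (-1)).trans ?_
    have e1 : _ = L11 μ f θ := hs.crossed_formula_hessian_score
    have e2 : _ = L14 μ f θ := hs.crossed_formula_hessian_hessian
    have e3 : _ = L25 μ f θ := hs.crossed_formula_cubic_hessian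
    have e4 : _ = L21 μ f θ := hs.crossed_formula_cubic_score
    linear_combination -e1 - e2 + e3 + e4
  · rw [hcross]
    ring
  · refine (htrace (-1)).trans ?_
    have e1 : _ = L12 μ f θ := MomentSymmetry.traced_formula_hessian_score
    have e2 : _ = L15 μ f θ := MomentSymmetry.traced_formula_hessian_hessian
    have e3 : _ = L26 μ f θ := MomentSymmetry.traced_formula_cubic_hessian
    have e4 : _ = L22 μ f θ := hs.traced_formula_cubic_score
    linear_combination -e1 - e2 + e3 + e4
  · rw [htrace]
    ring
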